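/- Let $\mathrm{Nil}$ be the group of real matrices $\begin{pmatrix}1&x&z\\0&1&y\\0&0&1\end{pmatrix}$ with the left-invariant metric $ds^2=dx^2+dy^2+(dz-x\,dy)^2$, and let $e_1,e_2,e_3$ be the orthonormal basis of its Lie algebra that equals $\partial_x,\partial_y,\partial_z$ at the unit. Let $M$ be a closed oriented surface smoothly immersed in $\mathrm{Nil}$ by $f$, regarded as a compact Riemann surface with the conformal structure of the induced metric; that is, $M$ is a compact Riemann surface and $f:M\to\mathrm{Nil}$ is a smooth conformal immersion. In a conformal parameter $z=x+iy$ the induced metric is $e^{2\alpha}\,dz\,d\bar z$ and the induced area measure is $d\mu=e^{2\alpha}\,dx\,dy$. Write $f^{-1}\partial f=\sum_k Z_ke_k$ with $\partial=\frac12(\partial_x-i\partial_y)$. A smooth function $\psi=(\psi_1,\psi_2)$ such that $$Z_1=\tfrac i2(\bar\psi_2^2+\psi_1^2),\qquad Z_2=\tfrac12(\bar\psi_2^2-\psi_1^2),\qquad Z_3=\psi_1\bar\psi_2$$ is called a generating spinor, and continuous functions $U,V$ such that $$\partial\psi_2+U\psi_1=0,\qquad -\bar\partial\psi_1+V\psi_2=0$$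 are called its potentials. Generating spinors and potentials exist locally around every point of $M$, and the energy $$E(M)=\int_M UV\,dx\wedge dy$$ is well defined, i.e. $M$ can be cut into finitely many disjoint Borel pieces, each lying in the domain of a conformal parameter with a generating spinor and potentials, the integral converges absolutely on each piece, and the sum of the integrals over the pieces does not depend on the choice of the pieces, the parameters, the spinors and the potentials. Moreover $$E(M)=\frac14\int_M\Big(H^2+\frac{\widehat K}{4}-\frac1{16}\Big)\,d\mu,$$ where the integrand on the right is integrable, $H$ is the mean curvature of the surface (half the trace of the second fundamental form) and $\widehat K$ is the sectional curvature of $\mathrm{Nil}$ along the tangent plane of the surface. In particular $E(M)$ is real. -/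

import Mathlib

open MeasureTheory
open scoped Manifold ContDiff Matrix

noncomputable section

/-! ## The group Nil with its left-invariant metric -/

/-- The group `Nil` of real matrices `!![1, x, z; 0, 1, y; 0, 0, 1]`. -/
def Nil : Subgroup (Matrix.SpecialLinearGroup (Fin 3) ℝ) where
  carrier := {A | ∃ x y z : ℝ,
    (A : Matrix (Fin 3) (Fin 3) ℝ) = !![1, x, z; 0, 1, y; 0, 0, 1]}
  one_mem' := ⟨0, 0, 0, by ext i j; fin_cases i <;> fin_cases j <;> simp⟩
  mul_mem' := by
    rintro A B ⟨x, y, z, hA⟩ ⟨x', y', z', hB⟩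
    refine ⟨x + x', y + y', z' + x * y' + z, ?_⟩
    rw [Matrix.SpecialLinearGroup.coe_mul, hA, hB]
    ext i j
    fin_cases i <;> fin_cases j <;> simp [Matrix.mul_apply, Fin.sum_univ_three, add_comm]
  inv_mem' := by
    rintro A ⟨x, y, z, hA⟩
    refine ⟨-x, -y, x * y - z, ?_⟩
    rw [Matrix.SpecialLinearGroup.coe_inv, hA, Matrix.adjugate_fin_three]
    ext i j
    fin_cases i <;> fin_cases j <;> simp

namespace Nil

/-- The basis `e₁, e₂, e₃` of the Lie algebra of `Nil`. -/
def basis : Fin 3 → Matrix (Fin 3) (Fin 3) ℝ :=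
  ![!![0, 1, 0; 0, 0, 0; 0, 0, 0], !![0, 0, 0; 0, 0, 1; 0, 0, 0], !![0, 0, 1; 0, 0, 0; 0, 0, 0]]

/-- The coordinates, in the basis `e₁, e₂, e₃`, of a matrix in the Lie algebra of `Nil`. The inner
product on the Lie algebra that makes the basis orthonormal is the dot product of coordinates. -/
def coords (A : Matrix (Fin 3) (Fin 3) ℝ) : Fin 3 → ℝ :=
  fun k => Matrix.trace ((basis k)ᵀ * A)

/-- The coordinates of the left translate `g⁻¹ X` to the unit of a tangent vector `X` at `g`. -/
def leftCoords (g : Nil) (X : Matrix (Fin 3) (Fin 3) ℝ) : Fin 3 → ℝ :=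
  coords (((g⁻¹ : Nil) : Matrix.SpecialLinearGroup (Fin 3) ℝ) * X)

/-- The left-invariant metric on `Nil` for which `e₁, e₂, e₃` are orthonormal at the unit. -/
def metric (g : Nil) (X Y : Matrix (Fin 3) (Fin 3) ℝ) : ℝ :=
  leftCoords g X ⬝ᵥ leftCoords g Y

theorem coords_apply (A : Matrix (Fin 3) (Fin 3) ℝ) (k : Fin 3) :
    coords A k = ![A 0 1, A 1 2, A 0 2] k := by
  fin_cases k <;>
    simp [coords, basis, Matrix.trace, Fin.sum_univ_three,
      Matrix.mul_apply]

/-- The metric is `dx² + dy² + (dz - x dy)²`. -/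
theorem metric_self (g : Nil) {x y z : ℝ}
    (hg : ((g : Matrix.SpecialLinearGroup (Fin 3) ℝ) : Matrix (Fin 3) (Fin 3) ℝ) =
      !![1, x, z; 0, 1, y; 0, 0, 1]) (dx dy dz : ℝ) :
    metric g !![0, dx, dz; 0, 0, dy; 0, 0, 0] !![0, dx, dz; 0, 0, dy; 0, 0, 0] =
      dx ^ 2 + dy ^ 2 + (dz - x * dy) ^ 2 := by
  simp only [metric, leftCoords, dotProduct, coords_apply, Subgroup.coe_inv,
    Matrix.SpecialLinearGroup.coe_inv, hg, Matrix.adjugate_fin_three]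
  simp [Fin.sum_univ_three]
  ring

/-- The structure constants `α i j k = ⟨[e i, e j], e k⟩`. -/
def structureConst (i j k : Fin 3) : ℝ :=
  coords (basis i * basis j - basis j * basis i) k

/-- The bracket of left-invariant vector fields, in coordinates. -/
def bracket (X Y : Fin 3 → ℝ) : Fin 3 → ℝ :=
  fun k => ∑ i, ∑ j, X i * Y j * structureConst i j k

/-- The coefficient `⟨∇_{e k} (e j), e i⟩` of the Levi-Civita connection of the left-invariant
metric (Koszul formula in the orthonormal left-invariant frame). -/
def connCoeff (k j i : Fin 3) : ℝ :=
  (structureConst k j i + structureConst i k j + structureConst i j k) / 2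

/-- The Levi-Civita connection on left-invariant vector fields, in coordinates. -/
def nabla (X Y : Fin 3 → ℝ) : Fin 3 → ℝ :=
  fun i => ∑ k, ∑ j, X k * Y j * connCoeff k j i

theorem structureConst_swap (i j k : Fin 3) :
    structureConst j i k = -structureConst i j k := by
  simp only [structureConst, coords, ← Matrix.trace_neg, ← Matrix.mul_neg, neg_sub]

/-- The connection is torsion-free: `∇_X Y - ∇_Y X = [X, Y]`. -/
theorem connCoeff_torsionFree (k j i : Fin 3) :
    connCoeff k j i - connCoeff j k i = structureConst k j i := by
  simp only [connCoeff]
  linarith [structureConst_swap k j i]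

/-- The connection is metric: `⟨∇_X Y, W⟩ + ⟨Y, ∇_X W⟩ = 0` for left-invariant fields. -/
theorem connCoeff_metric (k j i : Fin 3) : connCoeff k j i + connCoeff k i j = 0 := by
  simp only [connCoeff]
  linarith [structureConst_swap k j i, structureConst_swap i k j, structureConst_swap i j k]

/-- The curvature tensor `R(X,Y)W = ∇_Y ∇_X W - ∇_X ∇_Y W + ∇_{[X,Y]} W`. -/
def curvature (X Y W : Fin 3 → ℝ) : Fin 3 → ℝ :=
  nabla Y (nabla X W) - nabla X (nabla Y W) + nabla (bracket X Y) W

/-- The sectional curvature of the plane spanned by two linearly independent vectors. -/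
def sectionalCurvature (X Y : Fin 3 → ℝ) : ℝ :=
  (curvature X Y X ⬝ᵥ Y) / ((X ⬝ᵥ X) * (Y ⬝ᵥ Y) - (X ⬝ᵥ Y) ^ 2)

/-! ## Surfaces in Nil -/

section Surface

variable {M : Type*} [TopologicalSpace M]

/-- The derivative `∂_v f` in direction `v`, a matrix tangent to `Nil`, at the point `z` of the
domain of the parameter `c`. -/
def dirDeriv (f : M → Nil) (c : OpenPartialHomeomorph M ℂ) (v z : ℂ) :
    Matrix (Fin 3) (Fin 3) ℝ :=
  Matrix.of fun i j => fderiv ℝ (fun w => ((f (c.symm w) : Matrix.SpecialLinearGroup (Fin 3) ℝ) :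
    Matrix (Fin 3) (Fin 3) ℝ) i j) z v

/-- The left translate `f⁻¹ ∂_v f`, in coordinates. -/
def leftDeriv (f : M → Nil) (c : OpenPartialHomeomorph M ℂ) (v z : ℂ) : Fin 3 → ℝ :=
  leftCoords (f (c.symm z)) (dirDeriv f c v z)

/-- The coefficients of the first fundamental form in the parameter `c`:
`firstForm f c v w z = ⟨∂_v f, ∂_w f⟩`. -/
def firstForm (f : M → Nil) (c : OpenPartialHomeomorph M ℂ) (v w z : ℂ) : ℝ :=
  metric (f (c.symm z)) (dirDeriv f c v z) (dirDeriv f c w z)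

/-- `E G - F²` for the first fundamental form `E dx² + 2 F dx dy + G dy²`. -/
def firstFormDet (f : M → Nil) (c : OpenPartialHomeomorph M ℂ) (z : ℂ) : ℝ :=
  firstForm f c 1 1 z * firstForm f c Complex.I Complex.I z - firstForm f c 1 Complex.I z ^ 2

/-- The left translate `f⁻¹(N)` of the unit normal, with `(∂_x f, ∂_y f, N)` positively oriented
(the basis `e₁, e₂, e₃` being positively oriented). -/
def unitNormal (f : M → Nil) (c : OpenPartialHomeomorph M ℂ) (z : ℂ) : Fin 3 → ℝ :=
  let n := leftDeriv f c 1 z ⨯₃ leftDeriv f c Complex.I z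
  (Real.sqrt (n ⬝ᵥ n))⁻¹ • n

/-- The left translate of the covariant derivative `∇_{∂_v f} (∂_w f)` along `f`. -/
def covDeriv (f : M → Nil) (c : OpenPartialHomeomorph M ℂ) (v w z : ℂ) : Fin 3 → ℝ :=
  fun k => fderiv ℝ (fun ζ => leftDeriv f c w ζ k) z v +
    nabla (leftDeriv f c v z) (leftDeriv f c w z) k

/-- The second fundamental form `⟨∇_{∂_v f} (∂_w f), N⟩`. -/
def secondForm (f : M → Nil) (c : OpenPartialHomeomorph M ℂ) (v w z : ℂ) : ℝ :=
  covDeriv f c v w z ⬝ᵥ unitNormal f c z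

/-- The mean curvature, half the trace of the second fundamental form with respect to the first,
computed in the parameter `c`. -/
def meanCurvatureIn (f : M → Nil) (c : OpenPartialHomeomorph M ℂ) (z : ℂ) : ℝ :=
  (firstForm f c Complex.I Complex.I z * secondForm f c 1 1 z
    - 2 * firstForm f c 1 Complex.I z * secondForm f c 1 Complex.I z
    + firstForm f c 1 1 z * secondForm f c Complex.I Complex.I z) / (2 * firstFormDet f c z)

/-- The mean curvature `H` of the surface at a point. -/
def meanCurvature [ChartedSpace ℂ M] (f : M → Nil) (p : M) : ℝ :=
  meanCurvatureIn f (chartAt ℂ p) (chartAt ℂ p p)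

/-- The sectional curvature in `Nil` of the tangent plane of the surface at a point. -/
def tangentCurvature [ChartedSpace ℂ M] (f : M → Nil) (p : M) : ℝ :=
  sectionalCurvature (leftDeriv f (chartAt ℂ p) 1 (chartAt ℂ p p))
    (leftDeriv f (chartAt ℂ p) Complex.I (chartAt ℂ p p))

/-- The area measure of the induced metric, in the domain of one parameter:
`√(E G - F²) dx dy`. -/
def localArea [MeasurableSpace M] (f : M → Nil) (c : OpenPartialHomeomorph M ℂ) : Measure M :=
  (((volume : Measure ℂ).restrict c.target).withDensity
    fun z => ENNReal.ofReal (Real.sqrt (firstFormDet f c z))).map c.symm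

/-- The induced area measure `dμ` on the surface. The local area measures agree on overlaps, and
their supremum is the measure that restricts to each of them. -/
def areaMeasure [ChartedSpace ℂ M] [MeasurableSpace M] (f : M → Nil) : Measure M :=
  ⨆ c ∈ atlas ℂ M, localArea f c

/-- A smooth immersion of a Riemann surface in `Nil` for which the local complex coordinates are
conformal parameters of the induced metric. -/
structure IsConformalImmersion [ChartedSpace ℂ M] (f : M → Nil) : Prop where
  smooth : ∀ i j, ContMDiff 𝓘(ℝ, ℂ) 𝓘(ℝ, ℝ) ∞ fun p =>
    ((f p : Matrix.SpecialLinearGroup (Fin 3) ℝ) : Matrix (Fin 3) (Fin 3) ℝ) i j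
  immersion : ∀ c ∈ atlas ℂ M, ∀ z ∈ c.target,
    LinearIndependent ℝ ![leftDeriv f c 1 z, leftDeriv f c Complex.I z]
  conformal : ∀ c ∈ atlas ℂ M, ∀ z ∈ c.target,
    firstForm f c 1 1 z = firstForm f c Complex.I Complex.I z ∧ firstForm f c 1 Complex.I z = 0

/-! ## Generating spinors, Dirac potentials and the energy -/

/-- The Wirtinger derivative `∂ = (∂_x - i ∂_y) / 2`. -/
def dz (g : ℂ → ℂ) (z : ℂ) : ℂ :=
  (fderiv ℝ g z 1 - Complex.I * fderiv ℝ g z Complex.I) / 2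

/-- The Wirtinger derivative `∂̄ = (∂_x + i ∂_y) / 2`. -/
def dzbar (g : ℂ → ℂ) (z : ℂ) : ℂ :=
  (fderiv ℝ g z 1 + Complex.I * fderiv ℝ g z Complex.I) / 2

/-- The components `Z₁, Z₂, Z₃` of `Ψ = f⁻¹ ∂f`. -/
def Zcomp (f : M → Nil) (c : OpenPartialHomeomorph M ℂ) (k : Fin 3) (z : ℂ) : ℂ :=
  ((leftDeriv f c 1 z k : ℂ) - Complex.I * (leftDeriv f c Complex.I z k : ℂ)) / 2

/-- `ψ = (ψ₁, ψ₂)` is a generating spinor of the surface on the set `D` of values of the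
parameter `c`. -/
structure IsGeneratingSpinor (f : M → Nil) (c : OpenPartialHomeomorph M ℂ) (D : Set ℂ)
    (ψ₁ ψ₂ : ℂ → ℂ) : Prop where
  smooth₁ : ContDiffOn ℝ ∞ ψ₁ D
  smooth₂ : ContDiffOn ℝ ∞ ψ₂ D
  eq₁ : ∀ z ∈ D, Zcomp f c 0 z = Complex.I / 2 * ((star (ψ₂ z)) ^ 2 + ψ₁ z ^ 2)
  eq₂ : ∀ z ∈ D, Zcomp f c 1 z = 1 / 2 * ((star (ψ₂ z)) ^ 2 - ψ₁ z ^ 2)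
  eq₃ : ∀ z ∈ D, Zcomp f c 2 z = ψ₁ z * star (ψ₂ z)

/-- `U`, `V` are continuous potentials on `D` of a Dirac operator annihilating `ψ`:
`∂ψ₂ + U ψ₁ = 0` and `-∂̄ψ₁ + V ψ₂ = 0`. -/
structure IsDiracPotential (D : Set ℂ) (ψ₁ ψ₂ U V : ℂ → ℂ) : Prop where
  continuous₁ : ContinuousOn U D
  continuous₂ : ContinuousOn V D
  eq₁ : ∀ z ∈ D, dz ψ₂ z + U z * ψ₁ z = 0
  eq₂ : ∀ z ∈ D, -dzbar ψ₁ z + V z * ψ₂ z = 0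

/-- A representation of the surface by generating spinors: a cutting of the surface into finitely
many disjoint Borel pieces, and around each piece a conformal parameter, a generating spinor and
the potentials of its Dirac operator. -/
structure SpinorRepresentation [ChartedSpace ℂ M] [MeasurableSpace M] (f : M → Nil) where
  n : ℕ
  piece : Fin n → Set M
  measurable_piece : ∀ i, MeasurableSet (piece i)
  disjoint_piece : Pairwise fun i j => Disjoint (piece i) (piece j)
  cover : ⋃ i, piece i = Set.univ
  param : Fin n → OpenPartialHomeomorph M ℂ
  param_mem : ∀ i, param i ∈ IsManifold.maximalAtlas 𝓘(ℂ, ℂ) ω M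
  piece_subset : ∀ i, piece i ⊆ (param i).source
  dom : Fin n → Set ℂ
  isOpen_dom : ∀ i, IsOpen (dom i)
  dom_subset : ∀ i, dom i ⊆ (param i).target
  image_subset : ∀ i, param i '' piece i ⊆ dom i
  ψ₁ : Fin n → ℂ → ℂ
  ψ₂ : Fin n → ℂ → ℂ
  U : Fin n → ℂ → ℂ
  V : Fin n → ℂ → ℂ
  spinor : ∀ i, IsGeneratingSpinor f (param i) (dom i) (ψ₁ i) (ψ₂ i)
  dirac : ∀ i, IsDiracPotential (dom i) (ψ₁ i) (ψ₂ i) (U i) (V i)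

/-- Integrability on the surface of the 2-form `U V dx ∧ dy`. -/
def SpinorRepresentation.IsIntegrable [ChartedSpace ℂ M] [MeasurableSpace M] {f : M → Nil}
    (S : SpinorRepresentation f) : Prop :=
  ∀ i, IntegrableOn (fun z => S.U i z * S.V i z) (S.param i '' S.piece i)

/-- The energy `E(M) = ∫_M U V dx ∧ dy`. -/
def SpinorRepresentation.energy [ChartedSpace ℂ M] [MeasurableSpace M] {f : M → Nil}
    (S : SpinorRepresentation f) : ℂ :=
  ∑ i, ∫ z in S.param i '' S.piece i, S.U i z * S.V i z

end Surface

end Nil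

end

noncomputable section

namespace Nil

/-! ### Algebra of the left-invariant frame -/

/-! The energy form is computed pointwise in terms of the mean curvature `H` and the third
coordinate `N₃` of the unit normal. Conformality of `f` means `Z₁² + Z₂² + Z₃² = 0`, that is `Z₃² =
(-i Z₁ - Z₂)(-i Z₁ + Z₂)`; the two factors are `ψ₁²` and `ψ̄₂²`, so a spinor is found by extracting
a local square root. In its terms `e^α = |ψ₁|² + |ψ₂|²` and `N₃ e^α = |ψ₂|² - |ψ₁|²`.

The derivatives `∂̄Z_k` are determined by the Maurer-Cartan equation (`IsSmoothParam.maurerCartan`)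
and by the tension vector being `2H ∂_x f × ∂_y f` (`IsConformalParam.tension_eq`). Written in
spinors, they are the Dirac equation with `U = V = e^α (H/2 + i N₃/4)` (`IsGeneratingSpinor.dirac`).
No component of a spinor vanishes on an open set, so continuous potentials must take this value
(`IsDiracPotential.eq_diracPotential`). Hence `U V dx dy = (H²/4 - N₃²/16 + (i/4) H N₃) dμ`, where
the right side involves only the surface. This gives the independence of choices and, by compactness
and continuity, the integrability.

Since the sectional curvature of the tangent plane is `1/4 - N₃²`, the real part is the asserted
integrand. The imaginary part integrates to zero: `e₃` is a Killing field, so its tangential part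
has divergence `2 H N₃` (`IsConformalImmersion.integral_meanCurvature_mul_normalThirdAt`). -/

theorem nabla_apply (X Y : Fin 3 → ℝ) :
    nabla X Y = ![(X 1 * Y 2 + X 2 * Y 1) / 2, -(X 0 * Y 2 + X 2 * Y 0) / 2,
      (X 0 * Y 1 - X 1 * Y 0) / 2] := by
  ext i
  fin_cases i <;>
    simp [nabla, connCoeff, structureConst, coords_apply, basis, Fin.sum_univ_three,
      Matrix.mul_apply] <;>
    ring

theorem bracket_apply (X Y : Fin 3 → ℝ) :
    bracket X Y = ![0, 0, X 0 * Y 1 - X 1 * Y 0] := by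
  ext i
  fin_cases i <;>
    simp [bracket, structureConst, coords_apply, basis, Fin.sum_univ_three,
      Matrix.mul_apply]
  ring

/-- The only nonzero bracket of basis vectors is `[e₁, e₂] = ±e₃` up to order. Planes containing
`e₃` therefore have curvature `1/4`, the plane of `e₁, e₂` has `-3/4`, and the last square measures
the projection of the bivector to that plane. -/
theorem curvature_dotProduct (X Y : Fin 3 → ℝ) :
    curvature X Y X ⬝ᵥ Y =
      ((X ⬝ᵥ X) * (Y ⬝ᵥ Y) - (X ⬝ᵥ Y) ^ 2) / 4 - (X 0 * Y 1 - X 1 * Y 0) ^ 2 := by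
  simp only [curvature, nabla_apply, bracket_apply, dotProduct, Fin.sum_univ_three, Pi.add_apply,
    Pi.sub_apply]
  simp
  ring

/-- The sectional curvature of a plane is `1/4 - N₃²`, where `N` is its unit normal. -/
theorem sectionalCurvature_of_conformal {X Y : Fin 3 → ℝ} (hE : 0 < X ⬝ᵥ X)
    (hG : X ⬝ᵥ X = Y ⬝ᵥ Y) (hF : X ⬝ᵥ Y = 0) :
    sectionalCurvature X Y = 1 / 4 - ((X 0 * Y 1 - X 1 * Y 0) / (X ⬝ᵥ X)) ^ 2 := by
  rw [sectionalCurvature, curvature_dotProduct, hF, ← hG]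
  field_simp
  ring

theorem crossProduct_apply_two (a b : Fin 3 → ℝ) : (a ⨯₃ b) 2 = a 0 * b 1 - a 1 * b 0 := by
  simp [cross_apply]

theorem crossProduct_dotProduct_self {a b : Fin 3 → ℝ} (hG : a ⬝ᵥ a = b ⬝ᵥ b)
    (hF : a ⬝ᵥ b = 0) : (a ⨯₃ b) ⬝ᵥ (a ⨯₃ b) = (a ⬝ᵥ a) ^ 2 := by
  have h : (a ⨯₃ b) ⬝ᵥ (a ⨯₃ b) = (a ⬝ᵥ a) * (b ⬝ᵥ b) - (a ⬝ᵥ b) ^ 2 := by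
    simp only [cross_apply, dotProduct, Fin.sum_univ_three]
    simp
    ring
  rw [h, hF, ← hG]
  ring

/-- A vector orthogonal to `a` and `b` is a multiple of `a × b`. -/
theorem eq_smul_crossProduct {a b S : Fin 3 → ℝ} (hE : 0 < a ⬝ᵥ a) (hG : a ⬝ᵥ a = b ⬝ᵥ b)
    (hF : a ⬝ᵥ b = 0) (ha : S ⬝ᵥ a = 0) (hb : S ⬝ᵥ b = 0) :
    S = (S ⬝ᵥ (a ⨯₃ b) / (a ⬝ᵥ a) ^ 2) • (a ⨯₃ b) := by
  have hn := crossProduct_dotProduct_self hG hF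
  -- The triple product is `a (S·b) - b (S·a)`. Expanding `n × (S × n) = 0` with `n = a × b` then
  -- gives `(n·n) S = (S·n) n`.
  have hz : S ⨯₃ (a ⨯₃ b) = 0 := by
    ext k
    simp only [cross_apply, dotProduct, Fin.sum_univ_three] at ha hb ⊢
    fin_cases k
    · simp; linear_combination a 0 * hb - b 0 * ha
    · simp; linear_combination a 1 * hb - b 1 * ha
    · simp; linear_combination a 2 * hb - b 2 * ha
  generalize a ⨯₃ b = n at *
  ext k
  rw [Pi.smul_apply, smul_eq_mul, div_mul_eq_mul_div, eq_div_iff (by positivity), ← hn]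
  have h0 := congrFun hz 0
  have h1 := congrFun hz 1
  have h2 := congrFun hz 2
  simp [cross_apply] at h0 h1 h2
  simp only [dotProduct, Fin.sum_univ_three]
  fin_cases k
  · simp; linear_combination n 1 * h2 - n 2 * h1
  · simp; linear_combination n 2 * h0 - n 0 * h2
  · simp; linear_combination n 0 * h1 - n 1 * h0

/-! ### Matrix entries of the elements of `Nil` -/

/-- The coframe dual to `e₁, e₂, e₃` is `dx`, `dy`, `dz - x dy`. The three vanishing entries are
those that would mix into these coordinates after multiplication by `g⁻¹`. -/
theorem leftCoords_of_tangent (g : Nil) (X : Matrix (Fin 3) (Fin 3) ℝ) (h11 : X 1 1 = 0)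
    (h21 : X 2 1 = 0) (h22 : X 2 2 = 0) :
    leftCoords g X = ![X 0 1, X 1 2, X 0 2 -
      ((g : Matrix.SpecialLinearGroup (Fin 3) ℝ) : Matrix (Fin 3) (Fin 3) ℝ) 0 1 * X 1 2] := by
  obtain ⟨x, y, z, hg⟩ := g.2
  ext k
  simp only [leftCoords, coords_apply, Subgroup.coe_inv, Matrix.SpecialLinearGroup.coe_inv, hg,
    Matrix.adjugate_fin_three]
  fin_cases k <;> simp [Matrix.mul_apply, Fin.sum_univ_three, h11, h21, h22]
  ring

section Surface

variable {M : Type*} [TopologicalSpace M]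

/-- A matrix entry of the surface as a function of the parameter. -/
def entry (f : M → Nil) (c : OpenPartialHomeomorph M ℂ) (i j : Fin 3) (w : ℂ) : ℝ :=
  ((f (c.symm w) : Matrix.SpecialLinearGroup (Fin 3) ℝ) : Matrix (Fin 3) (Fin 3) ℝ) i j

theorem dirDeriv_apply (f : M → Nil) (c : OpenPartialHomeomorph M ℂ) (v z : ℂ) (i j : Fin 3) :
    dirDeriv f c v z i j = fderiv ℝ (entry f c i j) z v := rfl

theorem leftDeriv_eq (f : M → Nil) (c : OpenPartialHomeomorph M ℂ) (v z : ℂ) :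
    leftDeriv f c v z = ![fderiv ℝ (entry f c 0 1) z v, fderiv ℝ (entry f c 1 2) z v,
      fderiv ℝ (entry f c 0 2) z v - entry f c 0 1 z * fderiv ℝ (entry f c 1 2) z v] := by
  -- The diagonal and subdiagonal entries are constant on `Nil`, so their derivatives vanish.
  have key : ∀ i j : Fin 3, ∀ r : ℝ, (∀ w, entry f c i j w = r) →
      dirDeriv f c v z i j = 0 := by
    intro i j r h
    rw [dirDeriv_apply, funext h]
    simp
  rw [leftDeriv, leftCoords_of_tangent _ _ (key 1 1 1 ?_) (key 2 1 0 ?_) (key 2 2 1 ?_)]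
  · rfl
  all_goals
    intro w
    obtain ⟨x, y, t, hg⟩ := (f (c.symm w)).2
    simp [entry, hg]

theorem leftDeriv_linear (f : M → Nil) (c : OpenPartialHomeomorph M ℂ) (v z : ℂ) :
    leftDeriv f c v z =
      v.re • leftDeriv f c 1 z + v.im • leftDeriv f c Complex.I z := by
  have hv : v = v.re • (1 : ℂ) + v.im • Complex.I := by
    simp [Complex.re_add_im]
  have key : ∀ L : ℂ →L[ℝ] ℝ, L v = v.re * L 1 + v.im * L Complex.I := by
    intro L
    conv_lhs => rw [hv]
    simp only [map_add, map_smul, smul_eq_mul]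
  ext k
  simp only [leftDeriv_eq, key _]
  fin_cases k <;> simp
  ring

/-! ### Fundamental forms in a conformal parameter. -/

theorem firstForm_eq (f : M → Nil) (c : OpenPartialHomeomorph M ℂ) (v w z : ℂ) :
    firstForm f c v w z = leftDeriv f c v z ⬝ᵥ leftDeriv f c w z := rfl

/-- The parameter `c` is a regular conformal parameter of the surface. -/
def IsConformalParam (f : M → Nil) (c : OpenPartialHomeomorph M ℂ) : Prop :=
  ∀ z ∈ c.target, 0 < firstForm f c 1 1 z ∧
    firstForm f c 1 1 z = firstForm f c Complex.I Complex.I z ∧ firstForm f c 1 Complex.I z = 0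

/-- The entries of the surface are smooth functions of the parameter `c`. -/
def IsSmoothParam (f : M → Nil) (c : OpenPartialHomeomorph M ℂ) : Prop :=
  ∀ i j, ContDiffOn ℝ ∞ (entry f c i j) c.target

/-- The normal `∂_x f × ∂_y f`, translated to the unit. -/
def normal (f : M → Nil) (c : OpenPartialHomeomorph M ℂ) (z : ℂ) : Fin 3 → ℝ :=
  leftDeriv f c 1 z ⨯₃ leftDeriv f c Complex.I z

/-- The vector `∇_{∂_x f} ∂_x f + ∇_{∂_y f} ∂_y f`, translated to the unit. -/
def tension (f : M → Nil) (c : OpenPartialHomeomorph M ℂ) (z : ℂ) : Fin 3 → ℝ :=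
  covDeriv f c 1 1 z + covDeriv f c Complex.I Complex.I z

/-- The third coordinate of the unit normal, in a conformal parameter. -/
def normalThird (f : M → Nil) (c : OpenPartialHomeomorph M ℂ) (z : ℂ) : ℝ :=
  normal f c z 2 / firstForm f c 1 1 z

variable {f : M → Nil} {c : OpenPartialHomeomorph M ℂ} {z : ℂ}

theorem IsConformalParam.firstFormDet_eq (hc : IsConformalParam f c) (hz : z ∈ c.target) :
    firstFormDet f c z = firstForm f c 1 1 z ^ 2 := by
  obtain ⟨-, hG, hF⟩ := hc z hz
  rw [firstFormDet, ← hG, hF]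
  ring

theorem IsConformalParam.sqrt_firstFormDet (hc : IsConformalParam f c) (hz : z ∈ c.target) :
    Real.sqrt (firstFormDet f c z) = firstForm f c 1 1 z := by
  rw [hc.firstFormDet_eq hz, Real.sqrt_sq (hc z hz).1.le]

/-- With `E = G` and `F = 0` only the plain trace of the second form survives, and the cross product
to be normalised has length `E`. -/
theorem IsConformalParam.meanCurvatureIn_eq (hc : IsConformalParam f c) (hz : z ∈ c.target) :
    meanCurvatureIn f c z =
      tension f c z ⬝ᵥ normal f c z / (2 * firstForm f c 1 1 z ^ 2) := by
  obtain ⟨hE, hG, hF⟩ := hc z hz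
  have hn := crossProduct_dotProduct_self (a := leftDeriv f c 1 z)
    (b := leftDeriv f c Complex.I z) hG hF
  rw [meanCurvatureIn, hc.firstFormDet_eq hz, ← hG, hF]
  simp only [secondForm, unitNormal, tension]
  rw [hn, ← firstForm_eq, Real.sqrt_sq hE.le, ← normal, add_dotProduct]
  simp only [dotProduct_smul, smul_eq_mul]
  field_simp
  ring

theorem IsConformalParam.sectionalCurvature_eq (hc : IsConformalParam f c)
    (hz : z ∈ c.target) :
    sectionalCurvature (leftDeriv f c 1 z) (leftDeriv f c Complex.I z) =
      1 / 4 - normalThird f c z ^ 2 := by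
  obtain ⟨hE, hG, hF⟩ := hc z hz
  rw [sectionalCurvature_of_conformal (X := leftDeriv f c 1 z)
    (Y := leftDeriv f c Complex.I z) hE hG hF, normalThird, normal, crossProduct_apply_two,
    firstForm_eq]

/-! ### Smoothness and the structure equations -/

theorem contDiffOn_fderiv_apply {F : Type*} [NormedAddCommGroup F] [NormedSpace ℝ F] {g : ℂ → F}
    {s : Set ℂ} (hs : IsOpen s)
    (hg : ContDiffOn ℝ ∞ g s) (v : ℂ) : ContDiffOn ℝ ∞ (fun z => fderiv ℝ g z v) s :=
  (hg.fderiv_of_isOpen hs (by simp)).clm_apply contDiffOn_const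

theorem IsSmoothParam.contDiffOn_leftDeriv (hs : IsSmoothParam f c) (v : ℂ) (k : Fin 3) :
    ContDiffOn ℝ ∞ (fun z => leftDeriv f c v z k) c.target := by
  have h := fun i j => contDiffOn_fderiv_apply c.open_target (hs i j) v
  simp only [leftDeriv_eq]
  fin_cases k
  · exact h 0 1
  · exact h 1 2
  · exact (h 0 2).sub ((hs 0 1).mul (h 1 2))

theorem IsSmoothParam.differentiableAt_leftDeriv (hs : IsSmoothParam f c) (hz : z ∈ c.target)
    (v : ℂ) (k : Fin 3) : DifferentiableAt ℝ (fun z => leftDeriv f c v z k) z :=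
  ((hs.contDiffOn_leftDeriv v k).contDiffAt (c.open_target.mem_nhds hz)).differentiableAt
    (by simp)

theorem fderiv_fderiv_comm {g : ℂ → ℝ} (hg : ContDiffAt ℝ ∞ g z) (v w : ℂ) :
    fderiv ℝ (fun ζ => fderiv ℝ g ζ v) z w = fderiv ℝ (fun ζ => fderiv ℝ g ζ w) z v := by
  have hd : DifferentiableAt ℝ (fderiv ℝ g) z :=
    (hg.fderiv_right (m := 1) (by exact WithTop.coe_le_coe.2 le_top)).differentiableAt (by simp)
  rw [fderiv_clm_apply hd (differentiableAt_const v),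
    fderiv_clm_apply hd (differentiableAt_const w)]
  have h2 : ContDiffAt ℝ 2 g z := hg.of_le (by exact WithTop.coe_le_coe.2 le_top)
  simpa using (h2.isSymmSndFDerivAt (by simp)).eq w v

/-- The Maurer-Cartan equation `d(f⁻¹ df) + (f⁻¹ df) ∧ (f⁻¹ df) = 0`. -/
theorem IsSmoothParam.maurerCartan (hs : IsSmoothParam f c) (hz : z ∈ c.target) (k : Fin 3) :
    fderiv ℝ (fun ζ => leftDeriv f c 1 ζ k) z Complex.I -
      fderiv ℝ (fun ζ => leftDeriv f c Complex.I ζ k) z 1 = ![0, 0, normal f c z 2] k := by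
  have hcd : ∀ i j, ContDiffAt ℝ ∞ (entry f c i j) z := fun i j =>
    (hs i j).contDiffAt (c.open_target.mem_nhds hz)
  have hd : ∀ i j v, DifferentiableAt ℝ (fun ζ => fderiv ℝ (entry f c i j) ζ v) z := fun i j v =>
    ((contDiffOn_fderiv_apply c.open_target (hs i j) v).contDiffAt
      (c.open_target.mem_nhds hz)).differentiableAt (by simp)
  have hx : DifferentiableAt ℝ (entry f c 0 1) z := (hcd 0 1).differentiableAt (by simp)
  rw [normal, crossProduct_apply_two]
  simp only [leftDeriv_eq]
  fin_cases k
  · simp [fderiv_fderiv_comm (hcd 0 1) 1 Complex.I]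
  · simp [fderiv_fderiv_comm (hcd 1 2) 1 Complex.I]
  -- The third coordinate is the form `dz - x dy`. In its exterior derivative the second derivatives
  -- cancel and the product rule leaves `dx ∧ dy`, which is the third coordinate of the cross
  -- product.
  · have key : ∀ v w, fderiv ℝ (fun ζ => fderiv ℝ (entry f c 0 2) ζ v -
        entry f c 0 1 ζ * fderiv ℝ (entry f c 1 2) ζ v) z w =
        fderiv ℝ (fun ζ => fderiv ℝ (entry f c 0 2) ζ v) z w -
        (entry f c 0 1 z * fderiv ℝ (fun ζ => fderiv ℝ (entry f c 1 2) ζ v) z w +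
          fderiv ℝ (entry f c 1 2) z v * fderiv ℝ (entry f c 0 1) z w) := by
      intro v w
      rw [fderiv_fun_sub (hd 0 2 v) (hx.fun_mul (hd 1 2 v)), fderiv_fun_mul hx (hd 1 2 v)]
      simp
    simp only [Fin.reduceFinMk, Matrix.cons_val]
    rw [key, key, fderiv_fderiv_comm (hcd 0 2) 1 Complex.I,
      fderiv_fderiv_comm (hcd 1 2) 1 Complex.I]
    ring

theorem IsSmoothParam.fderiv_firstForm (hs : IsSmoothParam f c) (hz : z ∈ c.target)
    (u v w : ℂ) :
    fderiv ℝ (firstForm f c v w) z u =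
      (fun k => fderiv ℝ (fun ζ => leftDeriv f c v ζ k) z u) ⬝ᵥ leftDeriv f c w z +
      leftDeriv f c v z ⬝ᵥ fun k => fderiv ℝ (fun ζ => leftDeriv f c w ζ k) z u := by
  have hd := fun v k => hs.differentiableAt_leftDeriv hz v k
  have : firstForm f c v w = fun ζ => ∑ k, leftDeriv f c v ζ k * leftDeriv f c w ζ k := rfl
  rw [this, fderiv_fun_sum fun k _ => (hd v k).fun_mul (hd w k)]
  simp only [dotProduct, sum_apply, ← Finset.sum_add_distrib]
  refine Finset.sum_congr rfl fun k _ => ?_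
  rw [fderiv_fun_mul (hd v k) (hd w k)]
  simp
  ring

/-- In a conformal parameter the tension vector is normal to the surface. -/
theorem IsConformalParam.tension_eq (hc : IsConformalParam f c) (hs : IsSmoothParam f c)
    (hz : z ∈ c.target) : tension f c z = (2 * meanCurvatureIn f c z) • normal f c z := by
  obtain ⟨hE, hG, hF⟩ := hc z hz
  have hnhds := c.open_target.mem_nhds hz
  have h1 : firstForm f c 1 1 =ᶠ[nhds z] firstForm f c Complex.I Complex.I := by
    filter_upwards [hnhds] with w hw using (hc w hw).2.1
  have h2 : firstForm f c 1 Complex.I =ᶠ[nhds z] fun _ => 0 := by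
    filter_upwards [hnhds] with w hw using (hc w hw).2.2
  have d1 : ∀ u, fderiv ℝ (firstForm f c 1 1) z u =
      fderiv ℝ (firstForm f c Complex.I Complex.I) z u := fun u => by rw [h1.fderiv_eq]
  have d2 : ∀ u, fderiv ℝ (firstForm f c 1 Complex.I) z u = 0 := fun u => by
    rw [h2.fderiv_eq]; simp
  simp only [hs.fderiv_firstForm hz] at d1 d2
  have mc := hs.maurerCartan hz
  have mc0 := mc 0
  have mc1 := mc 1
  have mc2 := mc 2
  rw [normal, crossProduct_apply_two] at mc0 mc1 mc2
  simp only [Matrix.cons_val] at mc0 mc1 mc2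
  -- By torsion-freeness `⟨∇_y f_y, f_x⟩ = ∂_y F - ⟨f_y, ∇_x f_y⟩ = ∂_y F - ∂_x G / 2`, which
  -- cancels `⟨∇_x f_x, f_x⟩ = ∂_x E / 2` because `E = G` and `F = 0`.
  have hta : tension f c z ⬝ᵥ leftDeriv f c 1 z = 0 := by
    have e1 := d1 1
    have e2 := d2 Complex.I
    simp only [tension, covDeriv, nabla_apply, dotProduct, Fin.sum_univ_three, Pi.add_apply,
      Matrix.cons_val] at e1 e2 ⊢
    linear_combination e1 / 2 + e2 - leftDeriv f c Complex.I z 0 * mc0 -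
      leftDeriv f c Complex.I z 1 * mc1 - leftDeriv f c Complex.I z 2 * mc2
  have htb : tension f c z ⬝ᵥ leftDeriv f c Complex.I z = 0 := by
    have e1 := d1 Complex.I
    have e2 := d2 1
    simp only [tension, covDeriv, nabla_apply, dotProduct, Fin.sum_univ_three, Pi.add_apply,
      Matrix.cons_val] at e1 e2 ⊢
    linear_combination -e1 / 2 + e2 + leftDeriv f c 1 z 0 * mc0 +
      leftDeriv f c 1 z 1 * mc1 + leftDeriv f c 1 z 2 * mc2
  rw [hc.meanCurvatureIn_eq hz]
  have key := eq_smul_crossProduct (a := leftDeriv f c 1 z) (b := leftDeriv f c Complex.I z)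
    hE hG hF hta htb
  rw [← firstForm_eq, ← normal] at key
  conv_lhs => rw [key]
  congr 1
  field_simp

end Surface

section Surface

variable {M : Type*} [TopologicalSpace M]
variable {f : M → Nil} {c c' : OpenPartialHomeomorph M ℂ} {z : ℂ}

/-! ### The Laplacian and the Wirtinger derivatives -/

/-- The vector `∂_x (f⁻¹ ∂_x f) + ∂_y (f⁻¹ ∂_y f)`. -/
def divLeftDeriv (f : M → Nil) (c : OpenPartialHomeomorph M ℂ) (z : ℂ) (k : Fin 3) : ℝ :=
  fderiv ℝ (fun ζ => leftDeriv f c 1 ζ k) z 1 +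
    fderiv ℝ (fun ζ => leftDeriv f c Complex.I ζ k) z Complex.I

theorem tension_apply (k : Fin 3) :
    tension f c z k = divLeftDeriv f c z k + nabla (leftDeriv f c 1 z) (leftDeriv f c 1 z) k +
      nabla (leftDeriv f c Complex.I z) (leftDeriv f c Complex.I z) k := by
  simp only [tension, covDeriv, divLeftDeriv, Pi.add_apply]
  ring

/-- The third coordinate of `∇_X X` is zero, which expresses that `e₃` is Killing. So the flat
divergence equals the third coordinate of the tension without correction terms. -/
theorem IsConformalParam.divLeftDeriv_two (hc : IsConformalParam f c) (hs : IsSmoothParam f c)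
    (hz : z ∈ c.target) :
    divLeftDeriv f c z 2 = 2 * meanCurvatureIn f c z * normal f c z 2 := by
  have h := congrFun (hc.tension_eq hs hz) 2
  rw [tension_apply] at h
  simp only [nabla_apply, Pi.smul_apply, smul_eq_mul, Matrix.cons_val] at h
  linear_combination h

theorem IsSmoothParam.hasFDerivAt_leftDeriv (hs : IsSmoothParam f c) (hz : z ∈ c.target)
    (v : ℂ) (k : Fin 3) : HasFDerivAt (fun ζ => leftDeriv f c v ζ k)
      (fderiv ℝ (fun ζ => leftDeriv f c v ζ k) z) z :=
  (hs.differentiableAt_leftDeriv hz v k).hasFDerivAt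

theorem IsSmoothParam.hasFDerivAt_Zcomp (hs : IsSmoothParam f c) (hz : z ∈ c.target)
    (k : Fin 3) : HasFDerivAt (Zcomp f c k)
      ((1 / 2 : ℂ) • (Complex.ofRealCLM ∘L fderiv ℝ (fun ζ => leftDeriv f c 1 ζ k) z -
        Complex.I • (Complex.ofRealCLM ∘L
          fderiv ℝ (fun ζ => leftDeriv f c Complex.I ζ k) z))) z := by
  have h1 := Complex.ofRealCLM.hasFDerivAt.comp z (hs.hasFDerivAt_leftDeriv hz 1 k)
  have h2 := Complex.ofRealCLM.hasFDerivAt.comp z (hs.hasFDerivAt_leftDeriv hz Complex.I k)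
  have h := (h1.sub (h2.const_smul Complex.I)).const_smul (1 / 2 : ℂ)
  refine h.congr_of_eventuallyEq (Filter.Eventually.of_forall fun w => ?_)
  simp [Zcomp]
  ring

/-- With `Z = (L₁ - i L₂)/2`, the real part of `4 ∂̄Z` is the divergence of `(L₁, L₂)`. The
imaginary part is the curl, given by the Maurer-Cartan equation. -/
theorem IsSmoothParam.dzbar_Zcomp (hs : IsSmoothParam f c) (hz : z ∈ c.target) (k : Fin 3) :
    4 * dzbar (Zcomp f c k) z =
      divLeftDeriv f c z k + Complex.I * (![0, 0, normal f c z 2] k : ℝ) := by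
  rw [dzbar, (hs.hasFDerivAt_Zcomp hz k).fderiv, ← hs.maurerCartan hz k, divLeftDeriv]
  simp
  linear_combination -((fderiv ℝ (fun ζ => leftDeriv f c Complex.I ζ k) z) Complex.I : ℂ) *
    Complex.I_sq

/-! ### Holomorphic changes of the parameter -/

theorem fderiv_comp_holomorphic {F : Type*} [NormedAddCommGroup F] [NormedSpace ℝ F] {g : ℂ → F}
    {φ : ℂ → ℂ} (hφ : DifferentiableAt ℂ φ z)
    (hg : DifferentiableAt ℝ g (φ z)) (v : ℂ) :
    fderiv ℝ (fun ζ => g (φ ζ)) z v = fderiv ℝ g (φ z) (deriv φ z * v) := by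
  have h : HasFDerivAt φ ((ContinuousLinearMap.toSpanSingleton ℂ (deriv φ z)).restrictScalars ℝ)
      z := hφ.hasDerivAt.hasFDerivAt.restrictScalars ℝ
  have := (hg.hasFDerivAt.comp z h).fderiv
  rw [show (fun ζ => g (φ ζ)) = g ∘ φ from rfl, this]
  simp [mul_comm]

theorem trans_source_mem (hz : z ∈ (c.symm ≫ₕ c').source) :
    z ∈ c.target ∧ (c.symm ≫ₕ c') z ∈ c'.target ∧
      c'.symm ((c.symm ≫ₕ c') z) = c.symm z := by
  rw [OpenPartialHomeomorph.trans_source] at hz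
  exact ⟨hz.1, c'.map_source hz.2, c'.left_inv hz.2⟩

theorem eventually_symm_comp_trans {X : Type*} (g : M → X) (hz : z ∈ (c.symm ≫ₕ c').source) :
    (fun ζ => g (c.symm ζ)) =ᶠ[nhds z] fun ζ => g (c'.symm ((c.symm ≫ₕ c') ζ)) := by
  filter_upwards [(c.symm ≫ₕ c').open_source.mem_nhds hz] with ζ hζ
  rw [(trans_source_mem hζ).2.2]

theorem differentiableAt_trans (hφ : DifferentiableOn ℂ (c.symm ≫ₕ c') (c.symm ≫ₕ c').source)
    (hz : z ∈ (c.symm ≫ₕ c').source) : DifferentiableAt ℂ (c.symm ≫ₕ c') z :=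
  (hφ z hz).differentiableAt ((c.symm ≫ₕ c').open_source.mem_nhds hz)

theorem leftDeriv_change (hs : IsSmoothParam f c')
    (hφ : DifferentiableOn ℂ (c.symm ≫ₕ c') (c.symm ≫ₕ c').source)
    (hz : z ∈ (c.symm ≫ₕ c').source) (v : ℂ) :
    leftDeriv f c v z =
      leftDeriv f c' (deriv (c.symm ≫ₕ c') z * v) ((c.symm ≫ₕ c') z) := by
  obtain ⟨-, hz', hzz⟩ := trans_source_mem hz
  have key : ∀ i j, fderiv ℝ (entry f c i j) z v =
      fderiv ℝ (entry f c' i j) ((c.symm ≫ₕ c') z) (deriv (c.symm ≫ₕ c') z * v) := by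
    intro i j
    have hd : DifferentiableAt ℝ (entry f c' i j) ((c.symm ≫ₕ c') z) :=
      ((hs i j).contDiffAt (c'.open_target.mem_nhds hz')).differentiableAt (by simp)
    rw [← fderiv_comp_holomorphic (differentiableAt_trans hφ hz) hd]
    exact congrArg (fun L : ℂ →L[ℝ] ℝ => L v) (Filter.EventuallyEq.fderiv_eq
      (eventually_symm_comp_trans (fun p => ((f p : Matrix.SpecialLinearGroup (Fin 3) ℝ) :
        Matrix (Fin 3) (Fin 3) ℝ) i j) hz))
  rw [leftDeriv_eq, leftDeriv_eq, key, key, key]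
  simp only [entry, hzz]

theorem leftDeriv_one_change (hs : IsSmoothParam f c')
    (hφ : DifferentiableOn ℂ (c.symm ≫ₕ c') (c.symm ≫ₕ c').source)
    (hz : z ∈ (c.symm ≫ₕ c').source) (k : Fin 3) :
    leftDeriv f c 1 z k =
      (deriv (c.symm ≫ₕ c') z).re * leftDeriv f c' 1 ((c.symm ≫ₕ c') z) k +
      (deriv (c.symm ≫ₕ c') z).im * leftDeriv f c' Complex.I ((c.symm ≫ₕ c') z) k := by
  rw [leftDeriv_change hs hφ hz, leftDeriv_linear]
  simp

theorem leftDeriv_I_change (hs : IsSmoothParam f c')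
    (hφ : DifferentiableOn ℂ (c.symm ≫ₕ c') (c.symm ≫ₕ c').source)
    (hz : z ∈ (c.symm ≫ₕ c').source) (k : Fin 3) :
    leftDeriv f c Complex.I z k =
      -(deriv (c.symm ≫ₕ c') z).im * leftDeriv f c' 1 ((c.symm ≫ₕ c') z) k +
      (deriv (c.symm ≫ₕ c') z).re * leftDeriv f c' Complex.I ((c.symm ≫ₕ c') z) k := by
  rw [leftDeriv_change hs hφ hz, leftDeriv_linear]
  simp

theorem Zcomp_change (hs : IsSmoothParam f c')
    (hφ : DifferentiableOn ℂ (c.symm ≫ₕ c') (c.symm ≫ₕ c').source)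
    (hz : z ∈ (c.symm ≫ₕ c').source) (k : Fin 3) :
    Zcomp f c k z = deriv (c.symm ≫ₕ c') z * Zcomp f c' k ((c.symm ≫ₕ c') z) := by
  rw [Zcomp, leftDeriv_one_change hs hφ hz, leftDeriv_I_change hs hφ hz, Zcomp]
  conv_rhs => rw [← Complex.re_add_im (deriv (c.symm ≫ₕ c') z)]
  push_cast
  linear_combination -((deriv (c.symm ≫ₕ c') z).im *
    leftDeriv f c' Complex.I ((c.symm ≫ₕ c') z) k : ℂ) / 2 * -Complex.I_sq

theorem normal_change (hs : IsSmoothParam f c')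
    (hφ : DifferentiableOn ℂ (c.symm ≫ₕ c') (c.symm ≫ₕ c').source)
    (hz : z ∈ (c.symm ≫ₕ c').source) :
    normal f c z =
      Complex.normSq (deriv (c.symm ≫ₕ c') z) • normal f c' ((c.symm ≫ₕ c') z) := by
  ext k
  simp only [normal, cross_apply, leftDeriv_one_change hs hφ hz, leftDeriv_I_change hs hφ hz,
    Complex.normSq_apply, Pi.smul_apply, smul_eq_mul]
  fin_cases k <;> simp <;> ring

/-- Conformality is assumed only for `c'` and obtained for `c`, so the formula can carry it from the
atlas to the maximal atlas. -/
theorem firstForm_change (hs : IsSmoothParam f c') (hc : IsConformalParam f c')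
    (hφ : DifferentiableOn ℂ (c.symm ≫ₕ c') (c.symm ≫ₕ c').source)
    (hz : z ∈ (c.symm ≫ₕ c').source) :
    firstForm f c 1 1 z = Complex.normSq (deriv (c.symm ≫ₕ c') z) *
        firstForm f c' 1 1 ((c.symm ≫ₕ c') z) ∧
      firstForm f c Complex.I Complex.I z = Complex.normSq (deriv (c.symm ≫ₕ c') z) *
        firstForm f c' 1 1 ((c.symm ≫ₕ c') z) ∧ firstForm f c 1 Complex.I z = 0 := by
  obtain ⟨-, hG, hF⟩ := hc _ (trans_source_mem hz).2.1
  simp only [firstForm_eq, dotProduct, Fin.sum_univ_three, leftDeriv_one_change hs hφ hz,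
    leftDeriv_I_change hs hφ hz, Complex.normSq_apply] at hG hF ⊢
  generalize (deriv (c.symm ≫ₕ c') z).re = u
  generalize (deriv (c.symm ≫ₕ c') z).im = v
  refine ⟨?_, ?_, ?_⟩
  · linear_combination 2 * u * v * hF - v ^ 2 * hG
  · linear_combination -2 * u * v * hF - u ^ 2 * hG
  · linear_combination (u ^ 2 - v ^ 2) * hF - u * v * hG

/-- The holomorphic factor `h` is a constant for `∂̄`, and the chain rule for a holomorphic `φ`
contributes only the conjugate of its derivative. -/
theorem dzbar_holomorphic_mul {φ g : ℂ → ℂ} {h : ℂ → ℂ} (hφ : DifferentiableAt ℂ φ z)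
    (hh : DifferentiableAt ℂ h z) (hg : DifferentiableAt ℝ g (φ z)) :
    dzbar (fun ζ => h ζ * g (φ ζ)) z = h z * star (deriv φ z) * dzbar g (φ z) := by
  have hgφ : DifferentiableAt ℝ (fun ζ => g (φ ζ)) z := hg.comp z (hφ.restrictScalars ℝ)
  have hh1 : ∀ v, fderiv ℝ h z v = deriv h z * v := fun v => by
    simpa using fderiv_comp_holomorphic (g := id) hh differentiableAt_id v
  have hlin : ∀ v : ℂ, fderiv ℝ g (φ z) v =
      v.re * fderiv ℝ g (φ z) 1 + v.im * fderiv ℝ g (φ z) Complex.I := by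
    intro v
    have hv : v = v.re • (1 : ℂ) + v.im • Complex.I := by simp [Complex.re_add_im]
    conv_lhs => rw [hv]
    rw [map_add, map_smul, map_smul, Complex.real_smul, Complex.real_smul]
  simp only [dzbar]
  rw [fderiv_fun_mul (hh.restrictScalars ℝ) hgφ]
  simp only [add_apply, smul_apply, smul_eq_mul,
    fderiv_comp_holomorphic hφ hg, hh1]
  rw [hlin (deriv φ z * 1), hlin (deriv φ z * Complex.I)]
  have hst : star (deriv φ z) = (deriv φ z).re - (deriv φ z).im * Complex.I := by
    apply Complex.ext <;> simp
  rw [hst]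
  simp
  linear_combination (g (φ z) * deriv h z / 2 + h z * (deriv φ z).im *
    fderiv ℝ g (φ z) Complex.I / 2) * Complex.I_sq

/-- The form `Z dz` transforms with the factor `φ'`, and applying `∂̄` adds the conjugate factor.
The real part of `4 ∂̄Z` thus scales by `|φ'|²`, with no second derivatives of `φ`. -/
theorem divLeftDeriv_change (hs : IsSmoothParam f c) (hs' : IsSmoothParam f c')
    (hφ : DifferentiableOn ℂ (c.symm ≫ₕ c') (c.symm ≫ₕ c').source)
    (hz : z ∈ (c.symm ≫ₕ c').source) (k : Fin 3) :
    divLeftDeriv f c z k = Complex.normSq (deriv (c.symm ≫ₕ c') z) *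
      divLeftDeriv f c' ((c.symm ≫ₕ c') z) k := by
  obtain ⟨hzc, hz', -⟩ := trans_source_mem hz
  have hev : Zcomp f c k =ᶠ[nhds z]
      fun ζ => deriv (c.symm ≫ₕ c') ζ * Zcomp f c' k ((c.symm ≫ₕ c') ζ) := by
    filter_upwards [(c.symm ≫ₕ c').open_source.mem_nhds hz] with ζ hζ
    exact Zcomp_change hs' hφ hζ k
  have hderiv : DifferentiableAt ℂ (deriv (c.symm ≫ₕ c')) z :=
    ((hφ.deriv (c.symm ≫ₕ c').open_source) z hz).differentiableAt
      ((c.symm ≫ₕ c').open_source.mem_nhds hz)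
  have h1 := dzbar_holomorphic_mul (differentiableAt_trans hφ hz) hderiv
    (hs'.hasFDerivAt_Zcomp hz' k).differentiableAt
  have h2 : dzbar (Zcomp f c k) z =
      dzbar (fun ζ => deriv (c.symm ≫ₕ c') ζ * Zcomp f c' k ((c.symm ≫ₕ c') ζ)) z := by
    rw [dzbar, hev.fderiv_eq, dzbar]
  have h3 : deriv (c.symm ≫ₕ c') z * star (deriv (c.symm ≫ₕ c') z) =
      (Complex.normSq (deriv (c.symm ≫ₕ c') z) : ℂ) := Complex.mul_conj _
  rw [h3] at h1
  have h4 : (4 : ℂ) * dzbar (Zcomp f c k) z = (Complex.normSq (deriv (c.symm ≫ₕ c') z) : ℂ) *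
      (4 * dzbar (Zcomp f c' k) ((c.symm ≫ₕ c') z)) := by
    rw [h2, h1]
    ring
  rw [hs.dzbar_Zcomp hzc, hs'.dzbar_Zcomp hz'] at h4
  simpa using congrArg Complex.re h4

theorem tension_change (hs : IsSmoothParam f c) (hs' : IsSmoothParam f c')
    (hφ : DifferentiableOn ℂ (c.symm ≫ₕ c') (c.symm ≫ₕ c').source)
    (hz : z ∈ (c.symm ≫ₕ c').source) :
    tension f c z =
      Complex.normSq (deriv (c.symm ≫ₕ c') z) • tension f c' ((c.symm ≫ₕ c') z) := by
  ext k
  rw [Pi.smul_apply, tension_apply, tension_apply, divLeftDeriv_change hs hs' hφ hz]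
  simp only [nabla_apply, leftDeriv_one_change hs' hφ hz, leftDeriv_I_change hs' hφ hz,
    Complex.normSq_apply, smul_eq_mul]
  fin_cases k <;> simp <;> ring

theorem normSq_deriv_trans_pos (hc : IsConformalParam f c) (hs' : IsSmoothParam f c')
    (hc' : IsConformalParam f c')
    (hφ : DifferentiableOn ℂ (c.symm ≫ₕ c') (c.symm ≫ₕ c').source)
    (hz : z ∈ (c.symm ≫ₕ c').source) : 0 < Complex.normSq (deriv (c.symm ≫ₕ c') z) := by
  obtain ⟨hzc, hz', -⟩ := trans_source_mem hz
  have h := (hc z hzc).1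
  rw [(firstForm_change hs' hc' hφ hz).1] at h
  exact pos_of_mul_pos_left h (hc' _ hz').1.le

theorem meanCurvatureIn_change (hs : IsSmoothParam f c) (hc : IsConformalParam f c)
    (hs' : IsSmoothParam f c') (hc' : IsConformalParam f c')
    (hφ : DifferentiableOn ℂ (c.symm ≫ₕ c') (c.symm ≫ₕ c').source)
    (hz : z ∈ (c.symm ≫ₕ c').source) :
    meanCurvatureIn f c z = meanCurvatureIn f c' ((c.symm ≫ₕ c') z) := by
  obtain ⟨hzc, hz', -⟩ := trans_source_mem hz
  have hpos := normSq_deriv_trans_pos hc hs' hc' hφ hz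
  have hE := (hc' _ hz').1
  rw [hc.meanCurvatureIn_eq hzc, hc'.meanCurvatureIn_eq hz', tension_change hs hs' hφ hz,
    normal_change hs' hφ hz, (firstForm_change hs' hc' hφ hz).1, smul_dotProduct,
    dotProduct_smul, smul_eq_mul, smul_eq_mul]
  field_simp

theorem normalThird_change (hc : IsConformalParam f c)
    (hs' : IsSmoothParam f c') (hc' : IsConformalParam f c')
    (hφ : DifferentiableOn ℂ (c.symm ≫ₕ c') (c.symm ≫ₕ c').source)
    (hz : z ∈ (c.symm ≫ₕ c').source) :
    normalThird f c z = normalThird f c' ((c.symm ≫ₕ c') z) := by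
  have hpos := normSq_deriv_trans_pos hc hs' hc' hφ hz
  have hE := (hc' _ (trans_source_mem hz).2.1).1
  rw [normalThird, normalThird, normal_change hs' hφ hz, (firstForm_change hs' hc' hφ hz).1,
    Pi.smul_apply, smul_eq_mul]
  field_simp

/-! ### Continuity in a conformal parameter -/

theorem IsSmoothParam.continuousOn_leftDeriv (hs : IsSmoothParam f c) (v : ℂ) (k : Fin 3) :
    ContinuousOn (fun z => leftDeriv f c v z k) c.target :=
  (hs.contDiffOn_leftDeriv v k).continuousOn

theorem IsSmoothParam.continuousOn_firstForm (hs : IsSmoothParam f c) (v w : ℂ) :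
    ContinuousOn (firstForm f c v w) c.target := by
  have : firstForm f c v w = fun z => ∑ k, leftDeriv f c v z k * leftDeriv f c w z k := rfl
  rw [this]
  exact continuousOn_finsetSum _ fun k _ =>
    (hs.continuousOn_leftDeriv v k).mul (hs.continuousOn_leftDeriv w k)

theorem IsSmoothParam.continuousOn_normal (hs : IsSmoothParam f c) (k : Fin 3) :
    ContinuousOn (fun z => normal f c z k) c.target := by
  have h := hs.continuousOn_leftDeriv
  simp only [normal, cross_apply]
  fin_cases k
  · exact ((h 1 1).mul (h Complex.I 2)).sub ((h 1 2).mul (h Complex.I 1))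
  · exact ((h 1 2).mul (h Complex.I 0)).sub ((h 1 0).mul (h Complex.I 2))
  · exact ((h 1 0).mul (h Complex.I 1)).sub ((h 1 1).mul (h Complex.I 0))

theorem IsSmoothParam.continuousOn_tension (hs : IsSmoothParam f c) (k : Fin 3) :
    ContinuousOn (fun z => tension f c z k) c.target := by
  have h := hs.continuousOn_leftDeriv
  have hd : ∀ v, ContinuousOn (fun z => fderiv ℝ (fun ζ => leftDeriv f c v ζ k) z v) c.target :=
    fun v => (contDiffOn_fderiv_apply c.open_target (hs.contDiffOn_leftDeriv v k) v).continuousOn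
  have hn : ∀ v, ContinuousOn (fun z => nabla (leftDeriv f c v z) (leftDeriv f c v z) k)
      c.target := by
    intro v
    simp only [nabla]
    exact continuousOn_finsetSum _ fun i _ => continuousOn_finsetSum _ fun j _ =>
      ((h v i).mul (h v j)).mul continuousOn_const
  exact ((hd 1).add (hn 1)).add ((hd Complex.I).add (hn Complex.I))

theorem IsConformalParam.continuousOn_meanCurvatureIn (hc : IsConformalParam f c)
    (hs : IsSmoothParam f c) : ContinuousOn (meanCurvatureIn f c) c.target := by
  refine ContinuousOn.congr (ContinuousOn.div ?_ ?_ fun z hz => ?_)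
    fun z hz => hc.meanCurvatureIn_eq hz
  · simp only [dotProduct]
    exact continuousOn_finsetSum _ fun k _ =>
      (hs.continuousOn_tension k).mul (hs.continuousOn_normal k)
  · exact continuousOn_const.mul ((hs.continuousOn_firstForm 1 1).pow 2)
  · have := (hc z hz).1
    positivity

theorem IsConformalParam.continuousOn_normalThird (hc : IsConformalParam f c)
    (hs : IsSmoothParam f c) : ContinuousOn (normalThird f c) c.target :=
  (hs.continuousOn_normal 2).div (hs.continuousOn_firstForm 1 1) fun z hz => (hc z hz).1.ne'

end Surface

section Surface

variable {M : Type*} [TopologicalSpace M] [ChartedSpace ℂ M]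
variable {f : M → Nil} {c c' : OpenPartialHomeomorph M ℂ} {p : M}

/-! ### Conformal parameters of a Riemann surface -/

theorem differentiableOn_trans (hc : c ∈ IsManifold.maximalAtlas 𝓘(ℂ, ℂ) ω M)
    (hc' : c' ∈ IsManifold.maximalAtlas 𝓘(ℂ, ℂ) ω M) :
    DifferentiableOn ℂ (c.symm ≫ₕ c') (c.symm ≫ₕ c').source :=
  (contMDiffOn_iff_contDiffOn.1 (contMDiffOn_of_mem_contDiffGroupoid
    (IsManifold.compatible_of_mem_maximalAtlas hc hc'))).differentiableOn (by simp)

theorem contDiffGroupoid_complex_le_real :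
    contDiffGroupoid ω 𝓘(ℂ, ℂ) ≤ contDiffGroupoid ∞ 𝓘(ℝ, ℂ) := by
  intro e he
  have h : ∀ e' : OpenPartialHomeomorph ℂ ℂ, e' ∈ contDiffGroupoid ω 𝓘(ℂ, ℂ) →
      ContDiffOn ℝ ∞ e' e'.source := fun e' he' =>
    ((contMDiffOn_iff_contDiffOn.1 (contMDiffOn_of_mem_contDiffGroupoid he')).restrict_scalars
      ℝ).of_le le_top
  change e ∈ contDiffGroupoid ∞ 𝓘(ℝ, ℂ)
  rw [contDiffGroupoid, mem_groupoid_of_pregroupoid, contDiffPregroupoid]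
  constructor
  · simpa using h e he
  · simpa using h e.symm (StructureGroupoid.symm _ he)

theorem maximalAtlas_complex_subset_real :
    IsManifold.maximalAtlas 𝓘(ℂ, ℂ) ω M ⊆ IsManifold.maximalAtlas 𝓘(ℝ, ℂ) ∞ M :=
  StructureGroupoid.maximalAtlas_mono contDiffGroupoid_complex_le_real

theorem mem_trans_source {M : Type*} [TopologicalSpace M] {c c' : OpenPartialHomeomorph M ℂ}
    {p : M} (hp : p ∈ c.source) (hp' : p ∈ c'.source) :
    c p ∈ (c.symm ≫ₕ c').source ∧ (c.symm ≫ₕ c') (c p) = c' p := by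
  rw [OpenPartialHomeomorph.trans_source, OpenPartialHomeomorph.coe_trans]
  simp [hp, hp']

theorem IsConformalImmersion.isConformalParam_of_mem_atlas (hf : IsConformalImmersion f)
    (hc : c ∈ atlas ℂ M) : IsConformalParam f c := by
  intro z hz
  refine ⟨?_, hf.conformal c hc z hz⟩
  have h := (hf.immersion c hc z hz).ne_zero 0
  rw [firstForm_eq]
  simp only [Matrix.cons_val_zero] at h
  exact lt_of_le_of_ne (Finset.sum_nonneg fun i _ => mul_self_nonneg _)
    (Ne.symm (mt dotProduct_self_eq_zero.1 h))

/-- The derivative of a holomorphic change of parameters does not vanish. -/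
theorem deriv_trans_ne_zero (hc : c ∈ IsManifold.maximalAtlas 𝓘(ℂ, ℂ) ω M)
    (hc' : c' ∈ IsManifold.maximalAtlas 𝓘(ℂ, ℂ) ω M) {z : ℂ}
    (hz : z ∈ (c.symm ≫ₕ c').source) : deriv (c.symm ≫ₕ c') z ≠ 0 := by
  obtain ⟨hzc, hz', hzz⟩ := trans_source_mem hz
  have h1 := differentiableAt_trans (differentiableOn_trans hc hc') hz
  have hz2 : (c.symm ≫ₕ c') z ∈ (c'.symm ≫ₕ c).source := by
    rw [OpenPartialHomeomorph.trans_source]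
    refine ⟨hz', ?_⟩
    rw [Set.mem_preimage, hzz]
    exact c.map_target hzc
  have h2 := differentiableAt_trans (differentiableOn_trans hc' hc) hz2
  have h3 := h2.hasDerivAt.comp z h1.hasDerivAt
  have h4 : ((c'.symm ≫ₕ c) ∘ (c.symm ≫ₕ c')) =ᶠ[nhds z] id := by
    filter_upwards [(c.symm ≫ₕ c').open_source.mem_nhds hz] with ζ hζ
    obtain ⟨hζc, -, hζζ⟩ := trans_source_mem hζ
    rw [Function.comp_apply, OpenPartialHomeomorph.coe_trans, Function.comp_apply, hζζ]
    exact c.right_inv hζc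
  have h5 := (h3.congr_of_eventuallyEq h4.symm).unique (hasDerivAt_id z)
  intro h
  rw [h, mul_zero] at h5
  exact zero_ne_one h5

/-- Quantities such as `meanCurvature` are computed in a chart that jumps with the point. Continuity
at `p` becomes visible once the chart is frozen at `p`, which invariance under changes of parameter
permits. -/
theorem continuous_of_param {X : Type*} [TopologicalSpace X] {g : M → X}
    {G : OpenPartialHomeomorph M ℂ → ℂ → X}
    (hG : ∀ p, ContinuousOn (G (chartAt ℂ p)) (chartAt ℂ p).target)
    (h : ∀ p, ∀ q ∈ (chartAt ℂ p).source, g q = G (chartAt ℂ p) (chartAt ℂ p q)) :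
    Continuous g := by
  rw [continuous_iff_continuousAt]
  intro p
  have h1 : ContinuousAt (fun q => G (chartAt ℂ p) (chartAt ℂ p q)) p :=
    ContinuousAt.comp (f := chartAt ℂ p)
      ((hG p).continuousAt ((chartAt ℂ p).open_target.mem_nhds (mem_chart_target ℂ p)))
      ((chartAt ℂ p).continuousAt (mem_chart_source ℂ p))
  refine h1.congr ?_
  filter_upwards [(chartAt ℂ p).open_source.mem_nhds (mem_chart_source ℂ p)] with q hq
  exact (h p q hq).symm

/-- The third coordinate `N₃` of the unit normal at a point of the surface. -/
def normalThirdAt (f : M → Nil) (p : M) : ℝ :=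
  normalThird f (chartAt ℂ p) (chartAt ℂ p p)

variable [IsManifold 𝓘(ℂ, ℂ) ω M]

theorem isManifold_real (M : Type*) [TopologicalSpace M] [ChartedSpace ℂ M]
    [IsManifold 𝓘(ℂ, ℂ) ω M] : IsManifold 𝓘(ℝ, ℂ) ∞ M where
  compatible he he' := contDiffGroupoid_complex_le_real (StructureGroupoid.compatible _ he he')

theorem chartAt_mem_maximalAtlas (p : M) :
    chartAt ℂ p ∈ IsManifold.maximalAtlas 𝓘(ℂ, ℂ) ω M :=
  IsManifold.chart_mem_maximalAtlas p

theorem contDiffOn_comp_symm {g : M → ℝ} (hg : ContMDiff 𝓘(ℝ, ℂ) 𝓘(ℝ, ℝ) ∞ g)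
    (hc : c ∈ IsManifold.maximalAtlas 𝓘(ℂ, ℂ) ω M) :
    ContDiffOn ℝ ∞ (fun w => g (c.symm w)) c.target := by
  have := isManifold_real M
  exact contMDiffOn_iff_contDiffOn.1 (hg.comp_contMDiffOn
    (contMDiffOn_symm_of_mem_maximalAtlas (maximalAtlas_complex_subset_real hc)))

theorem IsConformalImmersion.isSmoothParam (hf : IsConformalImmersion f)
    (hc : c ∈ IsManifold.maximalAtlas 𝓘(ℂ, ℂ) ω M) : IsSmoothParam f c :=
  fun i j => contDiffOn_comp_symm (hf.smooth i j) hc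

/-- The definition speaks of the charts of the atlas alone. A general parameter is compared with the
chart at the given point through a holomorphic map of nonzero derivative. -/
theorem IsConformalImmersion.isConformalParam (hf : IsConformalImmersion f)
    (hc : c ∈ IsManifold.maximalAtlas 𝓘(ℂ, ℂ) ω M) : IsConformalParam f c := by
  intro z hz
  have hc' := chartAt_mem_maximalAtlas (c.symm z)
  have hφ := differentiableOn_trans hc hc'
  have hzs : z ∈ (c.symm ≫ₕ chartAt ℂ (c.symm z)).source := by
    rw [OpenPartialHomeomorph.trans_source]
    exact ⟨hz, mem_chart_source ℂ _⟩
  have hcc := hf.isConformalParam_of_mem_atlas (chart_mem_atlas ℂ (c.symm z))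
  obtain ⟨h1, h2, h3⟩ := firstForm_change (hf.isSmoothParam hc') hcc hφ hzs
  refine ⟨?_, h1.trans h2.symm, h3⟩
  rw [h1]
  exact mul_pos (Complex.normSq_pos.2 (deriv_trans_ne_zero hc hc' hzs))
    (hcc _ (trans_source_mem hzs).2.1).1

theorem IsConformalImmersion.meanCurvature_eq (hf : IsConformalImmersion f)
    (hc : c ∈ IsManifold.maximalAtlas 𝓘(ℂ, ℂ) ω M) (hp : p ∈ c.source) :
    meanCurvature f p = meanCurvatureIn f c (c p) := by
  have hc' := chartAt_mem_maximalAtlas p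
  obtain ⟨h1, h2⟩ := mem_trans_source (mem_chart_source ℂ p) hp
  rw [meanCurvature, meanCurvatureIn_change (hf.isSmoothParam hc') (hf.isConformalParam hc')
    (hf.isSmoothParam hc) (hf.isConformalParam hc) (differentiableOn_trans hc' hc) h1, h2]

theorem IsConformalImmersion.normalThirdAt_eq (hf : IsConformalImmersion f)
    (hc : c ∈ IsManifold.maximalAtlas 𝓘(ℂ, ℂ) ω M) (hp : p ∈ c.source) :
    normalThirdAt f p = normalThird f c (c p) := by
  have hc' := chartAt_mem_maximalAtlas p
  obtain ⟨h1, h2⟩ := mem_trans_source (mem_chart_source ℂ p) hp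
  rw [normalThirdAt, normalThird_change (hf.isConformalParam hc')
    (hf.isSmoothParam hc) (hf.isConformalParam hc) (differentiableOn_trans hc' hc) h1, h2]

theorem IsConformalImmersion.tangentCurvature_eq (hf : IsConformalImmersion f) (p : M) :
    tangentCurvature f p = 1 / 4 - normalThirdAt f p ^ 2 :=
  (hf.isConformalParam (chartAt_mem_maximalAtlas p)).sectionalCurvature_eq
    (mem_chart_target ℂ p)

theorem IsConformalImmersion.continuous_meanCurvature (hf : IsConformalImmersion f) :
    Continuous (meanCurvature f) :=
  continuous_of_param (G := meanCurvatureIn f)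
    (fun p => (hf.isConformalParam (chartAt_mem_maximalAtlas p)).continuousOn_meanCurvatureIn
      (hf.isSmoothParam (chartAt_mem_maximalAtlas p)))
    fun p _ hq => hf.meanCurvature_eq (chartAt_mem_maximalAtlas p) hq

theorem IsConformalImmersion.continuous_normalThirdAt (hf : IsConformalImmersion f) :
    Continuous (normalThirdAt f) :=
  continuous_of_param (G := normalThird f)
    (fun p => (hf.isConformalParam (chartAt_mem_maximalAtlas p)).continuousOn_normalThird
      (hf.isSmoothParam (chartAt_mem_maximalAtlas p)))
    fun p _ hq => hf.normalThirdAt_eq (chartAt_mem_maximalAtlas p) hq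

end Surface

section Surface

/-! ### The area measure -/

theorem exists_finite_borel_partition {M : Type*} [TopologicalSpace M] [CompactSpace M]
    [MeasurableSpace M] [BorelSpace M] (U : M → Set M) (hU : ∀ x, IsOpen (U x))
    (hx : ∀ x, x ∈ U x) :
    ∃ (n : ℕ) (x : Fin n → M) (P : Fin n → Set M), (∀ i, MeasurableSet (P i)) ∧
      (Pairwise fun i j => Disjoint (P i) (P j)) ∧ (⋃ i, P i = Set.univ) ∧
      ∀ i, P i ⊆ U (x i) := by
  obtain ⟨t, ht⟩ := isCompact_univ.elim_nhds_subcover U fun x _ => (hU x).mem_nhds (hx x)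
  let e := t.equivFin.symm
  refine ⟨t.card, fun i => e i, fun i => U (e i) \ ⋃ j < i, U (e j), fun i => ?_, ?_, ?_,
    fun i => Set.sdiff_subset⟩
  · exact (hU _).measurableSet.diff (.biUnion (Set.to_countable _) fun j _ => (hU _).measurableSet)
  · have key : ∀ i j, i < j →
        Disjoint (U (e i) \ ⋃ k < i, U (e k)) (U (e j) \ ⋃ k < j, U (e k)) := by
      intro i j hij
      rw [Set.disjoint_left]
      rintro p ⟨h1, -⟩ ⟨-, h2⟩
      exact h2 (Set.mem_biUnion hij h1)
    intro i j hij
    rcases lt_or_gt_of_ne hij with h | h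
    · exact key i j h
    · exact (key j i h).symm
  · refine Set.eq_univ_of_forall fun p => ?_
    have hne : ({i | p ∈ U (e i)} : Set (Fin t.card)).Nonempty := by
      obtain ⟨y, hy, hpy⟩ := Set.mem_iUnion₂.1 (ht.2 (Set.mem_univ p))
      exact ⟨t.equivFin ⟨y, hy⟩, by simpa [e] using hpy⟩
    -- The piece containing `p` is the one of the least index whose open set contains `p`.
    refine Set.mem_iUnion.2 ⟨wellFounded_lt.min _ hne, wellFounded_lt.min_mem _ hne, fun h => ?_⟩
    obtain ⟨j, hj, hpj⟩ := Set.mem_iUnion₂.1 h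
    exact wellFounded_lt.not_lt_min {i | p ∈ U (e i)} hpj hj

/-- The real determinant of multiplication by `w` is the norm of `w` from `ℂ` to `ℝ`. -/
theorem abs_det_toSpanSingleton (w : ℂ) :
    |((ContinuousLinearMap.toSpanSingleton ℂ w).restrictScalars ℝ).det| = Complex.normSq w := by
  have h : (((ContinuousLinearMap.toSpanSingleton ℂ w).restrictScalars ℝ : ℂ →L[ℝ] ℂ) :
      ℂ →ₗ[ℝ] ℂ) = Algebra.lmul ℝ ℂ w := by
    ext
    simp [mul_comm]
  rw [ContinuousLinearMap.det, h, ← Algebra.norm_apply, Algebra.norm_complex_apply,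
    abs_of_nonneg (Complex.normSq_nonneg w)]

variable {M : Type*} [TopologicalSpace M] [MeasurableSpace M] [BorelSpace M]
variable {f : M → Nil} {c c' : OpenPartialHomeomorph M ℂ} {S T : Set M}

theorem measurableSet_target_inter_preimage (hS : MeasurableSet S) :
    MeasurableSet (c.target ∩ c.symm ⁻¹' S) := by
  have h : Measurable (c.target.domRestrict c.symm) :=
    (continuousOn_iff_continuous_domRestrict.1 c.continuousOn_symm).measurable
  have := (c.open_target.measurableSet).subtype_image (h hS)
  convert this using 1
  ext z
  simp [Set.domRestrict, and_comm]

theorem measurableSet_image (hS : MeasurableSet S) (hSc : S ⊆ c.source) :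
    MeasurableSet (c '' S) := by
  rw [c.image_eq_target_inter_inv_preimage hSc]
  exact measurableSet_target_inter_preimage hS

theorem aemeasurable_symm {A : Set ℂ} (hA : MeasurableSet A) (hAc : A ⊆ c.target)
    (g : ℂ → ENNReal) :
    AEMeasurable c.symm ((volume.restrict A).withDensity g) :=
  ((c.continuousOn_symm.mono hAc).aemeasurable hA).mono_ac (withDensity_absolutelyContinuous _ _)

theorem map_symm_apply {A : Set ℂ} (hA : MeasurableSet A) (hAc : A ⊆ c.target)
    (g : ℂ → ENNReal) (hT : MeasurableSet T) :
    ((volume.restrict A).withDensity g).map c.symm T = ∫⁻ z in A ∩ c.symm ⁻¹' T, g z := by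
  rw [Measure.map_apply_of_aemeasurable (aemeasurable_symm hA hAc g) hT, withDensity_apply',
    Measure.restrict_restrict' hA, Set.inter_comm]

theorem localArea_apply (f : M → Nil) (c : OpenPartialHomeomorph M ℂ) (hT : MeasurableSet T) :
    localArea f c T = ∫⁻ z in c.target ∩ c.symm ⁻¹' T,
      ENNReal.ofReal (Real.sqrt (firstFormDet f c z)) :=
  map_symm_apply c.open_target.measurableSet subset_rfl _ hT

theorem localArea_inter_source (f : M → Nil) (c : OpenPartialHomeomorph M ℂ)
    (hT : MeasurableSet T) : localArea f c (T ∩ c.source) = localArea f c T := by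
  rw [localArea_apply f c hT, localArea_apply f c (hT.inter c.open_source.measurableSet)]
  congr 2
  ext z
  simp only [Set.mem_inter_iff, Set.mem_preimage]
  exact ⟨fun h => ⟨h.1, h.2.1⟩, fun h => ⟨h.1, h.2, c.map_target h.1⟩⟩

theorem IsConformalParam.localArea_apply (hc : IsConformalParam f c) (hT : MeasurableSet T) :
    localArea f c T = ∫⁻ z in c.target ∩ c.symm ⁻¹' T, ENNReal.ofReal (firstForm f c 1 1 z) := by
  rw [Nil.localArea_apply f c hT]
  exact setLIntegral_congr_fun (measurableSet_target_inter_preimage hT)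
    fun z hz => by rw [hc.sqrt_firstFormDet hz.1]

/-- The local area measures agree where they are both defined. -/
theorem localArea_eq_localArea (hc : IsConformalParam f c)
    (hs' : IsSmoothParam f c') (hc' : IsConformalParam f c')
    (hφ : DifferentiableOn ℂ (c.symm ≫ₕ c') (c.symm ≫ₕ c').source)
    (hS : MeasurableSet S) (hSc : S ⊆ c.source) (hSc' : S ⊆ c'.source) :
    localArea f c S = localArea f c' S := by
  rw [hc.localArea_apply hS, hc'.localArea_apply hS, ← c.image_eq_target_inter_inv_preimage hSc,
    ← c'.image_eq_target_inter_inv_preimage hSc']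
  have hsub : c '' S ⊆ (c.symm ≫ₕ c').source := by
    rintro _ ⟨p, hp, rfl⟩
    exact (mem_trans_source (hSc hp) (hSc' hp)).1
  have himg : c' '' S = (c.symm ≫ₕ c') '' (c '' S) := by
    rw [Set.image_image]
    exact Set.image_congr fun p hp => (mem_trans_source (hSc hp) (hSc' hp)).2.symm
  -- The Jacobian `|φ'|²` of the change of variables is exactly the factor relating the two
  -- conformal factors.
  rw [himg, lintegral_image_eq_lintegral_abs_det_fderiv_mul volume
    (measurableSet_image hS hSc) (fun z hz => (((differentiableAt_trans hφ
      (hsub hz)).hasDerivAt.hasFDerivAt).restrictScalars ℝ).hasFDerivWithinAt)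
    ((c.symm ≫ₕ c').injOn.mono hsub)]
  refine setLIntegral_congr_fun (measurableSet_image hS hSc) fun z hz => ?_
  rw [abs_det_toSpanSingleton, ← ENNReal.ofReal_mul (Complex.normSq_nonneg _),
    (firstForm_change hs' hc' hφ (hsub hz)).1]

theorem IsSmoothParam.aemeasurable_firstForm (hs : IsSmoothParam f c)
    (hS : MeasurableSet S) (hSc : S ⊆ c.source) :
    AEMeasurable (fun z => ENNReal.ofReal (firstForm f c 1 1 z)) (volume.restrict (c '' S)) := by
  have hsub : c '' S ⊆ c.target := by
    rw [c.image_eq_target_inter_inv_preimage hSc]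
    exact Set.inter_subset_left
  exact (((hs.continuousOn_firstForm 1 1).mono hsub).aemeasurable
    (measurableSet_image hS hSc)).ennreal_ofReal

theorem IsConformalParam.toReal_smul {M : Type*} [TopologicalSpace M] {f : M → Nil}
    {c : OpenPartialHomeomorph M ℂ} {S : Set M} {F : Type*} [NormedAddCommGroup F]
    [NormedSpace ℝ F] {g : M → F} (hc : IsConformalParam f c) (hSc : S ⊆ c.source) {z : ℂ}
    (hz : z ∈ c '' S) :
    (ENNReal.ofReal (firstForm f c 1 1 z)).toReal • g (c.symm z) =
      firstForm f c 1 1 z • g (c.symm z) := by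
  rw [c.image_eq_target_inter_inv_preimage hSc] at hz
  rw [ENNReal.toReal_ofReal (hc z hz.1).1.le]

variable [ChartedSpace ℂ M] [IsManifold 𝓘(ℂ, ℂ) ω M] [CompactSpace M]

/-- The area measure restricts to the local area measures. -/
theorem IsConformalImmersion.areaMeasure_restrict_source (hf : IsConformalImmersion f)
    (hc : c ∈ IsManifold.maximalAtlas 𝓘(ℂ, ℂ) ω M) :
    (areaMeasure f).restrict c.source = localArea f c := by
  obtain ⟨n, x, P, hPm, hPd, hPu, hPs⟩ := exists_finite_borel_partition
    (fun p : M => (chartAt ℂ p).source) (fun p => (chartAt ℂ p).open_source)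
    (mem_chart_source ℂ)
  have hsum : ∀ (μ : Measure M) {T : Set M}, MeasurableSet T → μ T = ∑ i, μ (T ∩ P i) := by
    intro μ T hT
    have hTu : T = ⋃ i, T ∩ P i := by rw [← Set.inter_iUnion, hPu, Set.inter_univ]
    conv_lhs => rw [hTu]
    rw [measure_iUnion
      (fun i j hij => (hPd hij).mono Set.inter_subset_right Set.inter_subset_right)
      fun i => hT.inter (hPm i), tsum_fintype]
  -- The supremum is replaced by an explicit measure, glued from the local areas along a finite
  -- disjoint partition.
  let μ : Measure M := ∑ i, (localArea f (chartAt ℂ (x i))).restrict (P i)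
  have hμ : ∀ {T : Set M}, MeasurableSet T →
      μ T = ∑ i, localArea f (chartAt ℂ (x i)) (T ∩ P i) := by
    intro T hT
    simp only [μ, Measure.coe_finsetSum, Finset.sum_apply]
    exact Finset.sum_congr rfl fun i _ => Measure.restrict_apply hT
  have hlocal : ∀ c ∈ IsManifold.maximalAtlas 𝓘(ℂ, ℂ) ω M,
      μ.restrict c.source = localArea f c := by
    intro c hc
    ext T hT
    have hTc := hT.inter c.open_source.measurableSet
    rw [Measure.restrict_apply hT, hμ hTc, ← localArea_inter_source f c hT, hsum _ hTc]
    refine Finset.sum_congr rfl fun i _ => Eq.symm ?_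
    have hi := chartAt_mem_maximalAtlas (x i)
    exact localArea_eq_localArea (hf.isConformalParam hc) (hf.isSmoothParam hi)
      (hf.isConformalParam hi) (differentiableOn_trans hc hi) (hTc.inter (hPm i))
      (Set.inter_subset_left.trans Set.inter_subset_right)
      (Set.inter_subset_right.trans (hPs i))
  -- Each local area is a restriction of `μ`, so `μ` is an upper bound. Conversely, on every piece
  -- `μ` coincides with one of the local areas in the supremum.
  have harea : areaMeasure f = μ := by
    refine le_antisymm (iSup₂_le fun c hc => ?_) (Measure.le_iff.2 fun T hT => ?_)
    · rw [← hlocal c (IsManifold.subset_maximalAtlas hc)]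
      exact Measure.restrict_le_self
    · rw [hμ hT, hsum _ hT]
      exact Finset.sum_le_sum fun i _ =>
        (le_iSup₂ (f := fun c (_ : c ∈ atlas ℂ M) => localArea f c) (chartAt ℂ (x i))
          (chart_mem_atlas ℂ (x i))) _
  rw [harea, hlocal c hc]

theorem IsConformalImmersion.areaMeasure_restrict (hf : IsConformalImmersion f)
    (hc : c ∈ IsManifold.maximalAtlas 𝓘(ℂ, ℂ) ω M) (hS : MeasurableSet S) (hSc : S ⊆ c.source) :
    (areaMeasure f).restrict S = ((volume.restrict (c '' S)).withDensity
      fun z => ENNReal.ofReal (firstForm f c 1 1 z)).map c.symm := by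
  have hsub : c '' S ⊆ c.target := by
    rw [c.image_eq_target_inter_inv_preimage hSc]
    exact Set.inter_subset_left
  ext T hT
  rw [map_symm_apply (measurableSet_image hS hSc) hsub _ hT, ← Set.inter_eq_left.2 hSc,
    ← Measure.restrict_restrict hS, hf.areaMeasure_restrict_source hc, Measure.restrict_apply hT,
    (hf.isConformalParam hc).localArea_apply (hT.inter hS), Set.inter_eq_left.2 hSc,
    c.image_eq_target_inter_inv_preimage hSc]
  congr 2
  ext z
  simp only [Set.mem_inter_iff, Set.mem_preimage]
  tauto

theorem IsConformalImmersion.isFiniteMeasure_areaMeasure (hf : IsConformalImmersion f) :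
    IsFiniteMeasure (areaMeasure f) := by
  -- Compactness reduces the claim to local finiteness, and `E` is integrable on a closed ball
  -- inside the target of a chart.
  refine ⟨isCompact_univ.measure_lt_top_of_nhdsWithin fun p _ => ?_⟩
  have hc := chartAt_mem_maximalAtlas p
  obtain ⟨r, hr, hball⟩ := Metric.nhds_basis_closedBall.mem_iff.1
    ((chartAt ℂ p).open_target.mem_nhds (mem_chart_target ℂ p))
  let K := Metric.closedBall (chartAt ℂ p p) r
  let V := (chartAt ℂ p).source ∩ chartAt ℂ p ⁻¹' Metric.ball (chartAt ℂ p p) r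
  have hVo : IsOpen V := (chartAt ℂ p).isOpen_inter_preimage Metric.isOpen_ball
  have hVp : p ∈ V := ⟨mem_chart_source ℂ p, Metric.mem_ball_self hr⟩
  refine ⟨V, mem_nhdsWithin_of_mem_nhds (hVo.mem_nhds hVp), ?_⟩
  rw [← Set.inter_eq_left.2 (show V ⊆ (chartAt ℂ p).source from Set.inter_subset_left),
    ← Measure.restrict_apply hVo.measurableSet, hf.areaMeasure_restrict_source hc,
    (hf.isConformalParam hc).localArea_apply hVo.measurableSet]
  have hsub : (chartAt ℂ p).target ∩ (chartAt ℂ p).symm ⁻¹' V ⊆ K := by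
    rintro z ⟨hz, -, hz2⟩
    rw [Set.mem_preimage, (chartAt ℂ p).right_inv hz] at hz2
    exact Metric.ball_subset_closedBall hz2
  refine (lintegral_mono_set hsub).trans_lt ?_
  have hint : IntegrableOn (firstForm f (chartAt ℂ p) 1 1) K :=
    (((hf.isSmoothParam hc).continuousOn_firstForm 1 1).mono hball).integrableOn_compact
      (isCompact_closedBall _ _)
  exact hint.lintegral_lt_top

/-! ### Integrals over the surface in a conformal parameter. -/

section Integral

variable {F : Type*} [NormedAddCommGroup F] [NormedSpace ℝ F] {g : M → F}

theorem IsConformalImmersion.setIntegral_areaMeasure (hf : IsConformalImmersion f)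
    (hc : c ∈ IsManifold.maximalAtlas 𝓘(ℂ, ℂ) ω M) (hS : MeasurableSet S) (hSc : S ⊆ c.source)
    (hg : AEStronglyMeasurable g (areaMeasure f)) :
    ∫ p in S, g p ∂areaMeasure f = ∫ z in c '' S, firstForm f c 1 1 z • g (c.symm z) := by
  have hsub : c '' S ⊆ c.target := by
    rw [c.image_eq_target_inter_inv_preimage hSc]
    exact Set.inter_subset_left
  have hg' := hg.mono_measure (Measure.restrict_le_self (s := S))
  have hm := measurableSet_image hS hSc
  rw [hf.areaMeasure_restrict hc hS hSc] at hg' ⊢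
  rw [integral_map (aemeasurable_symm hm hsub _) hg',
    integral_withDensity_eq_integral_toReal_smul₀ ((hf.isSmoothParam hc).aemeasurable_firstForm hS hSc)
      (Filter.Eventually.of_forall fun _ => ENNReal.ofReal_lt_top)]
  exact setIntegral_congr_fun hm fun z hz => (hf.isConformalParam hc).toReal_smul hSc hz

theorem IsConformalImmersion.integrableOn_areaMeasure (hf : IsConformalImmersion f)
    (hc : c ∈ IsManifold.maximalAtlas 𝓘(ℂ, ℂ) ω M) (hS : MeasurableSet S) (hSc : S ⊆ c.source)
    (hg : Integrable g (areaMeasure f)) :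
    IntegrableOn (fun z => firstForm f c 1 1 z • g (c.symm z)) (c '' S) := by
  have hsub : c '' S ⊆ c.target := by
    rw [c.image_eq_target_inter_inv_preimage hSc]
    exact Set.inter_subset_left
  have hg' := hg.integrableOn (s := S)
  have hm := measurableSet_image hS hSc
  rw [IntegrableOn, hf.areaMeasure_restrict hc hS hSc,
    integrable_map_measure ?_ (aemeasurable_symm hm hsub _),
    integrable_withDensity_iff_integrable_smul₀' ((hf.isSmoothParam hc).aemeasurable_firstForm hS hSc)
      (Filter.Eventually.of_forall fun _ => ENNReal.ofReal_lt_top)] at hg'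
  · exact (integrableOn_congr_fun (fun z hz => (hf.isConformalParam hc).toReal_smul hSc hz) hm).1 hg'
  · rw [← hf.areaMeasure_restrict hc hS hSc]
    exact hg.aestronglyMeasurable.mono_measure Measure.restrict_le_self

end Integral

end Surface

/-! ### The divergence theorem -/

theorem integral_fderiv_apply_eq_zero {h : ℂ → ℝ} (hh : ContDiff ℝ 1 h)
    (hsupp : HasCompactSupport h) (v : ℂ) :
    Integrable (fun z => fderiv ℝ h z v) ∧ ∫ z, fderiv ℝ h z v = 0 := by
  have hint : Integrable (fun z => fderiv ℝ h z v) :=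
    ((hh.continuous_fderiv (by simp)).clm_apply continuous_const).integrable_of_hasCompactSupport
      (hsupp.fderiv_apply ℝ v)
  refine ⟨hint, ?_⟩
  -- Integration by parts against the constant `1`, whose derivative is zero.
  have h1 := integral_mul_fderiv_eq_neg_fderiv_mul_of_integrable (μ := volume) (𝕜 := ℝ)
    (f := fun _ : ℂ => (1 : ℝ)) (g := h) (v := v) (by simp) (by simpa using hint)
    (by simpa using hh.continuous.integrable_of_hasCompactSupport hsupp)
    (fun _ _ => differentiableAt_const _) (fun z _ => hh.differentiable (by simp) z)
  simpa using h1

/-- A point outside `s` lies in the open complement of `K`, where the extension by zero vanishes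
identically. -/
theorem contDiff_indicator {s K : Set ℂ} (hs : IsOpen s) (hK : IsCompact K) (hKs : K ⊆ s)
    {h : ℂ → ℝ} (hh : ContDiffOn ℝ 1 h s) (h0 : ∀ z ∈ s, z ∉ K → h z = 0) :
    ContDiff ℝ 1 (s.indicator h) ∧ HasCompactSupport (s.indicator h) := by
  have hzero : ∀ z, z ∉ K → s.indicator h z = 0 := by
    intro z hz
    by_cases hzs : z ∈ s
    · rw [Set.indicator_of_mem hzs, h0 z hzs hz]
    · rw [Set.indicator_of_notMem hzs]
  refine ⟨contDiff_iff_contDiffAt.2 fun z => ?_, HasCompactSupport.intro hK hzero⟩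
  by_cases hz : z ∈ s
  · refine (hh.contDiffAt (hs.mem_nhds hz)).congr_of_eventuallyEq ?_
    filter_upwards [hs.mem_nhds hz] with w hw using Set.indicator_of_mem hw h
  · refine (contDiffAt_const (c := (0 : ℝ))).congr_of_eventuallyEq ?_
    filter_upwards [hK.isClosed.isOpen_compl.mem_nhds fun hzK => hz (hKs hzK)] with w hw
      using hzero w hw

theorem setIntegral_fderiv_eq_zero {s K : Set ℂ} (hs : IsOpen s) (hK : IsCompact K) (hKs : K ⊆ s)
    {h : ℂ → ℝ} (hh : ContDiffOn ℝ 1 h s) (h0 : ∀ z ∈ s, z ∉ K → h z = 0) (v : ℂ) :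
    IntegrableOn (fun z => fderiv ℝ h z v) s ∧ ∫ z in s, fderiv ℝ h z v = 0 := by
  obtain ⟨h1, h2⟩ := contDiff_indicator hs hK hKs hh h0
  obtain ⟨h3, h4⟩ := integral_fderiv_apply_eq_zero h1 h2 v
  have heq : ∀ z ∈ s, fderiv ℝ (s.indicator h) z v = fderiv ℝ h z v := by
    intro z hz
    have : s.indicator h =ᶠ[nhds z] h := by
      filter_upwards [hs.mem_nhds hz] with w hw using Set.indicator_of_mem hw h
    rw [this.fderiv_eq]
  have hoff : ∀ z, z ∉ s → fderiv ℝ (s.indicator h) z v = 0 := by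
    intro z hz
    have : s.indicator h =ᶠ[nhds z] fun _ => 0 := by
      filter_upwards [hK.isClosed.isOpen_compl.mem_nhds fun hzK => hz (hKs hzK)] with w hw
      by_cases hws : w ∈ s
      · rw [Set.indicator_of_mem hws, h0 w hws hw]
      · rw [Set.indicator_of_notMem hws]
    rw [this.fderiv_eq]
    simp
  refine ⟨(integrableOn_congr_fun heq hs.measurableSet).1 h3.integrableOn, ?_⟩
  rw [← setIntegral_congr_fun hs.measurableSet heq,
    setIntegral_eq_integral_of_forall_compl_eq_zero hoff, h4]

/-! ### The divergence of the tangential part of `e₃`. -/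

section Surface

variable {M : Type*} [TopologicalSpace M]

/-- The pairing of the gradient of `ρ` with the tangential part of `e₃`, in a conformal
parameter. -/
def verticalDerivIn (f : M → Nil) (ρ : M → ℝ) (c : OpenPartialHomeomorph M ℂ) (z : ℂ) : ℝ :=
  (fderiv ℝ (fun w => ρ (c.symm w)) z 1 * leftDeriv f c 1 z 2 +
    fderiv ℝ (fun w => ρ (c.symm w)) z Complex.I * leftDeriv f c Complex.I z 2) /
      firstForm f c 1 1 z

variable [ChartedSpace ℂ M]
variable {f : M → Nil} {c c' : OpenPartialHomeomorph M ℂ} {ρ : M → ℝ} {p : M}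

/-- The derivative of `ρ` along the tangential part of `e₃`. -/
def verticalDeriv (f : M → Nil) (ρ : M → ℝ) (p : M) : ℝ :=
  verticalDerivIn f ρ (chartAt ℂ p) (chartAt ℂ p p)

theorem verticalDeriv_eq_zero (hp : ρ =ᶠ[nhds p] 0) : verticalDeriv f ρ p = 0 := by
  have h : (fun w => ρ ((chartAt ℂ p).symm w)) =ᶠ[nhds (chartAt ℂ p p)] fun _ => 0 := by
    have ht := (chartAt ℂ p).continuousAt_symm (mem_chart_target ℂ p)
    rw [ContinuousAt, (chartAt ℂ p).left_inv (mem_chart_source ℂ p)] at ht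
    exact ht.eventually hp
  rw [verticalDeriv, verticalDerivIn, h.fderiv_eq]
  simp

variable [IsManifold 𝓘(ℂ, ℂ) ω M]

theorem differentiableAt_comp_symm (hρ : ContMDiff 𝓘(ℝ, ℂ) 𝓘(ℝ, ℝ) ∞ ρ)
    (hc : c ∈ IsManifold.maximalAtlas 𝓘(ℂ, ℂ) ω M) {z : ℂ} (hz : z ∈ c.target) :
    DifferentiableAt ℝ (fun w => ρ (c.symm w)) z :=
  ((contDiffOn_comp_symm hρ hc).contDiffAt (c.open_target.mem_nhds hz)).differentiableAt (by simp)

theorem IsConformalImmersion.verticalDeriv_eq (hf : IsConformalImmersion f)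
    (hρ : ContMDiff 𝓘(ℝ, ℂ) 𝓘(ℝ, ℝ) ∞ ρ)
    (hc : c ∈ IsManifold.maximalAtlas 𝓘(ℂ, ℂ) ω M) (hp : p ∈ c.source) :
    verticalDeriv f ρ p = verticalDerivIn f ρ c (c p) := by
  have hc' := chartAt_mem_maximalAtlas p
  obtain ⟨hz, h2⟩ := mem_trans_source (mem_chart_source ℂ p) hp
  obtain ⟨-, hz', -⟩ := trans_source_mem hz
  have hφ := differentiableOn_trans hc' hc
  have hs := hf.isSmoothParam hc
  have hpos := normSq_deriv_trans_pos (hf.isConformalParam hc') hs (hf.isConformalParam hc) hφ hz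
  have hE := (hf.isConformalParam hc _ hz').1
  have hd := differentiableAt_comp_symm hρ hc hz'
  have hfd : ∀ v, fderiv ℝ (fun w => ρ ((chartAt ℂ p).symm w)) (chartAt ℂ p p) v =
      (deriv ((chartAt ℂ p).symm ≫ₕ c) (chartAt ℂ p p) * v).re *
        fderiv ℝ (fun w => ρ (c.symm w)) (((chartAt ℂ p).symm ≫ₕ c) (chartAt ℂ p p)) 1 +
      (deriv ((chartAt ℂ p).symm ≫ₕ c) (chartAt ℂ p p) * v).im *
        fderiv ℝ (fun w => ρ (c.symm w)) (((chartAt ℂ p).symm ≫ₕ c) (chartAt ℂ p p))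
          Complex.I := by
    intro v
    rw [(eventually_symm_comp_trans ρ hz).fderiv_eq,
      fderiv_comp_holomorphic (differentiableAt_trans hφ hz) hd]
    generalize deriv ((chartAt ℂ p).symm ≫ₕ c) (chartAt ℂ p p) * v = u
    have hu : u = u.re • (1 : ℂ) + u.im • Complex.I := by simp [Complex.re_add_im]
    conv_lhs => rw [hu]
    rw [map_add, map_smul, map_smul, smul_eq_mul, smul_eq_mul]
  rw [verticalDeriv, verticalDerivIn, verticalDerivIn, hfd, hfd,
    leftDeriv_one_change hs hφ hz, leftDeriv_I_change hs hφ hz,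
    (firstForm_change hs (hf.isConformalParam hc) hφ hz).1, ← h2,
    div_eq_div_iff (by positivity) (by positivity), Complex.normSq_apply]
  simp
  ring

theorem IsConformalImmersion.continuous_verticalDeriv (hf : IsConformalImmersion f)
    (hρ : ContMDiff 𝓘(ℝ, ℂ) 𝓘(ℝ, ℝ) ∞ ρ) : Continuous (verticalDeriv f ρ) := by
  refine continuous_of_param (G := verticalDerivIn f ρ) (fun p => ?_)
    fun p _ hq => hf.verticalDeriv_eq hρ (chartAt_mem_maximalAtlas p) hq
  have hc := chartAt_mem_maximalAtlas p
  have hs := hf.isSmoothParam hc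
  have h := fun v => (contDiffOn_fderiv_apply (chartAt ℂ p).open_target
    (contDiffOn_comp_symm hρ hc) v).continuousOn
  exact (((h 1).mul (hs.continuousOn_leftDeriv 1 2)).add
    ((h Complex.I).mul (hs.continuousOn_leftDeriv Complex.I 2))).div
      (hs.continuousOn_firstForm 1 1) fun z hz => (hf.isConformalParam hc z hz).1.ne'

variable [CompactSpace M] [MeasurableSpace M] [BorelSpace M]

theorem IsConformalImmersion.integrable_of_continuous (hf : IsConformalImmersion f)
    {F : Type*} [NormedAddCommGroup F] [SecondCountableTopology F] {g : M → F}
    (hg : Continuous g) : Integrable g (areaMeasure f) := by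
  have := hf.isFiniteMeasure_areaMeasure
  have : SecondCountableTopology M := ChartedSpace.secondCountable_of_sigmaCompact ℂ M
  obtain ⟨C, hC⟩ := isCompact_univ.exists_bound_of_continuousOn hg.continuousOn
  exact Integrable.of_bound hg.aestronglyMeasurable C
    (Filter.Eventually.of_forall fun p => hC p (Set.mem_univ p))

/-- The divergence theorem for the field `ρ e₃ᵀ` with `ρ` supported in the domain of a
parameter. -/
theorem IsConformalImmersion.integral_divergence_of_tsupport (hf : IsConformalImmersion f)
    (hρ : ContMDiff 𝓘(ℝ, ℂ) 𝓘(ℝ, ℝ) ∞ ρ)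
    (hc : c ∈ IsManifold.maximalAtlas 𝓘(ℂ, ℂ) ω M) (hsupp : tsupport ρ ⊆ c.source) :
    ∫ p, (ρ p * (2 * meanCurvature f p * normalThirdAt f p) + verticalDeriv f ρ p)
      ∂areaMeasure f = 0 := by
  have hs := hf.isSmoothParam hc
  have hcc := hf.isConformalParam hc
  have hcont : Continuous fun p =>
      ρ p * (2 * meanCurvature f p * normalThirdAt f p) + verticalDeriv f ρ p :=
    (hρ.continuous.mul ((continuous_const.mul hf.continuous_meanCurvature).mul
      hf.continuous_normalThirdAt)).add (hf.continuous_verticalDeriv hρ)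
  have hoff : ∀ p, p ∉ c.source →
      ρ p * (2 * meanCurvature f p * normalThirdAt f p) + verticalDeriv f ρ p = 0 := by
    intro p hp
    have h0 : p ∉ tsupport ρ := fun h => hp (hsupp h)
    rw [image_eq_zero_of_notMem_tsupport h0,
      verticalDeriv_eq_zero (notMem_tsupport_iff_eventuallyEq.1 h0)]
    ring
  rw [← setIntegral_eq_integral_of_forall_compl_eq_zero hoff,
    hf.setIntegral_areaMeasure hc c.open_source.measurableSet subset_rfl
      (hf.integrable_of_continuous hcont).aestronglyMeasurable, c.image_source_eq_target]
  -- In a conformal parameter, `E` times the divergence of `ρ e₃ᵀ` is the flat divergence of `(h 1,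
  -- h I)`, whose components have compact support.
  let h : ℂ → ℂ → ℝ := fun v z => ρ (c.symm z) * leftDeriv f c v z 2
  have hh : ∀ v, ContDiffOn ℝ 1 (h v) c.target := fun v =>
    (((contDiffOn_comp_symm hρ hc).mul (hs.contDiffOn_leftDeriv v 2)).of_le
      (by exact WithTop.coe_le_coe.2 le_top))
  have hK : IsCompact (c '' tsupport ρ) :=
    (isClosed_tsupport ρ).isCompact.image_of_continuousOn (c.continuousOn.mono hsupp)
  have hKs : c '' tsupport ρ ⊆ c.target := by
    rintro _ ⟨p, hp, rfl⟩
    exact c.map_source (hsupp hp)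
  have h0 : ∀ v, ∀ z ∈ c.target, z ∉ c '' tsupport ρ → h v z = 0 := by
    intro v z hz hzK
    have : c.symm z ∉ tsupport ρ := fun hmem => hzK ⟨_, hmem, c.right_inv hz⟩
    simp [h, image_eq_zero_of_notMem_tsupport this]
  obtain ⟨i1, e1⟩ := setIntegral_fderiv_eq_zero c.open_target hK hKs (hh 1) (h0 1) 1
  obtain ⟨i2, e2⟩ := setIntegral_fderiv_eq_zero c.open_target hK hKs (hh Complex.I)
    (h0 Complex.I) Complex.I
  have e12 := integral_add i1 i2
  rw [e1, e2, add_zero] at e12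
  rw [← e12]
  refine setIntegral_congr_fun c.open_target.measurableSet fun z hz => ?_
  have hsrc := c.map_target hz
  have hd : ∀ v, fderiv ℝ (h v) z v = ρ (c.symm z) *
      fderiv ℝ (fun ζ => leftDeriv f c v ζ 2) z v +
      leftDeriv f c v z 2 * fderiv ℝ (fun w => ρ (c.symm w)) z v := by
    intro v
    simp only [h]
    rw [fderiv_fun_mul (differentiableAt_comp_symm hρ hc hz) (hs.differentiableAt_leftDeriv hz v 2)]
    simp
  have hE := (hcc z hz).1
  have hdiv := hcc.divLeftDeriv_two hs hz
  have hN : normal f c z 2 = normalThird f c z * firstForm f c 1 1 z := by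
    rw [normalThird, div_mul_cancel₀ _ hE.ne']
  rw [hN, divLeftDeriv] at hdiv
  simp only [hd, hf.meanCurvature_eq hc hsrc, hf.normalThirdAt_eq hc hsrc,
    hf.verticalDeriv_eq hρ hc hsrc, c.right_inv hz, verticalDerivIn, smul_eq_mul]
  rw [mul_add, mul_div_cancel₀ _ hE.ne']
  linear_combination -ρ (c.symm z) * hdiv

variable [T2Space M]

/-- The field `e₃` is Killing, so that `2 H N₃` is the divergence of its tangential part and its
integral vanishes. -/
theorem IsConformalImmersion.integral_meanCurvature_mul_normalThirdAt
    (hf : IsConformalImmersion f) :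
    ∫ p, meanCurvature f p * normalThirdAt f p ∂areaMeasure f = 0 := by
  have := isManifold_real M
  obtain ⟨n, x, P, -, -, hPu, hPs⟩ := exists_finite_borel_partition
    (fun p : M => (chartAt ℂ p).source) (fun p => (chartAt ℂ p).open_source)
    (mem_chart_source ℂ)
  obtain ⟨ρ, hρ⟩ := SmoothPartitionOfUnity.exists_isSubordinate 𝓘(ℝ, ℂ)
    (isClosed_univ (X := M)) (fun i => (chartAt ℂ (x i)).source)
    (fun i => (chartAt ℂ (x i)).open_source) (by
      rw [← hPu]
      exact Set.iUnion_mono hPs)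
  have hsum : ∀ p, ∑ i, ρ i p = 1 := fun p => by
    rw [← finsum_eq_sum_of_fintype]
    exact ρ.sum_eq_one (Set.mem_univ p)
  have hsm : ∀ i, ContMDiff 𝓘(ℝ, ℂ) 𝓘(ℝ, ℝ) ∞ (ρ i) := fun i => (ρ i).contMDiff
  -- The derivatives of a partition of unity add up to the derivative of `1`, so the gradient terms
  -- cancel in the sum.
  have hgrad : ∀ p, ∑ i, verticalDeriv f (ρ i) p = 0 := by
    intro p
    have hv : ∀ v, ∑ i, fderiv ℝ (fun w => ρ i ((chartAt ℂ p).symm w)) (chartAt ℂ p p) v = 0 := by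
      intro v
      rw [← sum_apply, ← fderiv_fun_sum fun i _ => differentiableAt_comp_symm (hsm i)
        (chartAt_mem_maximalAtlas p) (mem_chart_target ℂ p)]
      simp only [hsum]
      simp
    simp only [verticalDeriv, verticalDerivIn]
    rw [← Finset.sum_div, Finset.sum_add_distrib, ← Finset.sum_mul, ← Finset.sum_mul, hv, hv]
    simp
  have hHN : Continuous fun p => 2 * meanCurvature f p * normalThirdAt f p :=
    (continuous_const.mul hf.continuous_meanCurvature).mul hf.continuous_normalThirdAt
  have hint : ∀ i, Integrable (fun p => ρ i p * (2 * meanCurvature f p * normalThirdAt f p) +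
      verticalDeriv f (ρ i) p) (areaMeasure f) := fun i =>
    hf.integrable_of_continuous (((hsm i).continuous.mul hHN).add
      (hf.continuous_verticalDeriv (hsm i)))
  have key : ∑ i, ∫ p, (ρ i p * (2 * meanCurvature f p * normalThirdAt f p) +
      verticalDeriv f (ρ i) p) ∂areaMeasure f = 0 :=
    Finset.sum_eq_zero fun i _ => hf.integral_divergence_of_tsupport (hsm i)
      (chartAt_mem_maximalAtlas (x i)) (hρ i)
  rw [← integral_finsetSum _ fun i _ => hint i] at key
  simp only [Finset.sum_add_distrib, ← Finset.sum_mul, hsum, hgrad, one_mul, add_zero,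
    mul_assoc, integral_const_mul] at key
  simpa using key

end Surface

/-! ### Wirtinger calculus -/

section Wirtinger

variable {g h : ℂ → ℂ} {z : ℂ}

theorem dzbar_congr (hgh : g =ᶠ[nhds z] h) : dzbar g z = dzbar h z := by
  rw [dzbar, dzbar, hgh.fderiv_eq]

theorem dz_congr (hgh : g =ᶠ[nhds z] h) : dz g z = dz h z := by
  rw [dz, dz, hgh.fderiv_eq]

theorem dzbar_const (w : ℂ) : dzbar (fun _ => w) z = 0 := by
  simp [dzbar]

theorem dz_const (w : ℂ) : dz (fun _ => w) z = 0 := by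
  simp [dz]

theorem dzbar_add (hg : DifferentiableAt ℝ g z) (hh : DifferentiableAt ℝ h z) :
    dzbar (fun ζ => g ζ + h ζ) z = dzbar g z + dzbar h z := by
  simp only [dzbar, fderiv_fun_add hg hh, add_apply]
  ring

theorem dzbar_mul (hg : DifferentiableAt ℝ g z) (hh : DifferentiableAt ℝ h z) :
    dzbar (fun ζ => g ζ * h ζ) z = g z * dzbar h z + h z * dzbar g z := by
  simp only [dzbar, fderiv_fun_mul hg hh, add_apply, smul_apply, smul_eq_mul]
  ring

theorem dzbar_star (hg : DifferentiableAt ℝ g z) :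
    dzbar (fun ζ => star (g ζ)) z = star (dz g z) := by
  have h : HasFDerivAt (fun ζ => star (g ζ))
      ((Complex.conjCLE : ℂ →L[ℝ] ℂ) ∘L fderiv ℝ g z) z :=
    (Complex.conjCLE : ℂ →L[ℝ] ℂ).hasFDerivAt.comp z hg.hasFDerivAt
  rw [dzbar, h.fderiv, dz]
  simp

end Wirtinger

/-- The quotient `g / g z` is near `1`, where the principal logarithm is smooth. Half of it is
exponentiated and multiplied by a fixed square root of `g z`. -/
theorem exists_local_sqrt {g : ℂ → ℂ} {s : Set ℂ} (hs : IsOpen s) (hg : ContDiffOn ℝ ∞ g s)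
    {z : ℂ} (hz : z ∈ s) (h0 : g z ≠ 0) :
    ∃ D ⊆ s, IsOpen D ∧ z ∈ D ∧ ∃ r : ℂ → ℂ, ContDiffOn ℝ ∞ r D ∧
      ∀ ζ ∈ D, r ζ ^ 2 = g ζ ∧ r ζ ≠ 0 := by
  obtain ⟨w, hw⟩ := IsAlgClosed.exists_pow_nat_eq (g z) (n := 2) (by norm_num)
  have hw0 : w ≠ 0 := by
    rintro rfl
    exact h0 (by simpa using hw.symm)
  refine ⟨s ∩ (fun ζ => g ζ / g z) ⁻¹' Complex.slitPlane, Set.inter_subset_left,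
    (hg.continuousOn.div_const _).isOpen_inter_preimage hs Complex.isOpen_slitPlane,
    ⟨hz, by simp [div_self h0]⟩, fun ζ => w * Complex.exp (Complex.log (g ζ / g z) / 2), ?_, ?_⟩
  · intro ζ hζ
    have h1 : ContDiffWithinAt ℝ ∞ (fun ζ => g ζ / g z)
        (s ∩ (fun ζ => g ζ / g z) ⁻¹' Complex.slitPlane) ζ :=
      ((hg ζ hζ.1).mono Set.inter_subset_left).div_const _
    have h2 : ContDiffAt ℝ ∞ (fun u : ℂ => w * Complex.exp (Complex.log u / 2)) (g ζ / g z) :=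
      (contDiffAt_const.mul ((Complex.contDiffAt_log hζ.2).div_const 2).cexp).restrict_scalars ℝ
    exact ContDiffAt.comp_contDiffWithinAt (f := fun ζ => g ζ / g z) ζ h2 h1
  · intro ζ hζ
    have hne : g ζ / g z ≠ 0 := Complex.slitPlane_ne_zero hζ.2
    refine ⟨?_, mul_ne_zero hw0 (Complex.exp_ne_zero _)⟩
    rw [mul_pow, hw, ← Complex.exp_nat_mul]
    push_cast
    rw [mul_div_cancel₀ _ (two_ne_zero), Complex.exp_log hne, mul_div_cancel₀ _ h0]

section Surface

variable {M : Type*} [TopologicalSpace M]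
variable {f : M → Nil} {c : OpenPartialHomeomorph M ℂ} {z : ℂ}

/-! ### Existence of generating spinors -/

theorem IsSmoothParam.contDiffOn_Zcomp (hs : IsSmoothParam f c) (k : Fin 3) :
    ContDiffOn ℝ ∞ (Zcomp f c k) c.target := by
  have h := fun v => Complex.ofRealCLM.contDiff.comp_contDiffOn (hs.contDiffOn_leftDeriv v k)
  exact ((h 1).sub (contDiffOn_const.mul (h Complex.I))).div_const 2

/-- The real part of the sum is `(E - G)/4` and its imaginary part is `-F/2`. -/
theorem IsConformalParam.sum_sq_Zcomp (hc : IsConformalParam f c) (hz : z ∈ c.target) :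
    Zcomp f c 0 z ^ 2 + Zcomp f c 1 z ^ 2 + Zcomp f c 2 z ^ 2 = 0 := by
  obtain ⟨-, hG, hF⟩ := hc z hz
  simp only [firstForm_eq, dotProduct, Fin.sum_univ_three] at hG hF
  have hG' := congrArg (fun x : ℝ => (x : ℂ)) hG
  have hF' := congrArg (fun x : ℝ => (x : ℂ)) hF
  push_cast at hG' hF'
  simp only [Zcomp]
  linear_combination hG' / 4 - Complex.I / 2 * hF' + ((leftDeriv f c Complex.I z 0 : ℂ) ^ 2 +
    (leftDeriv f c Complex.I z 1 : ℂ) ^ 2 + (leftDeriv f c Complex.I z 2 : ℂ) ^ 2) / 4 *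
    Complex.I_sq

theorem IsConformalParam.exists_Zcomp_ne_zero (hc : IsConformalParam f c) (hz : z ∈ c.target) :
    ∃ k, Zcomp f c k z ≠ 0 := by
  by_contra! h
  have h1 : ∀ k, leftDeriv f c 1 z k = 0 := by
    intro k
    have := congrArg Complex.re (h k)
    simpa [Zcomp] using this
  have h2 := (hc z hz).1
  simp [firstForm_eq, dotProduct, h1] at h2

/-- A spinor must satisfy `ψ₁² = -i Z₁ - Z₂`, `ψ̄₂² = -i Z₁ + Z₂` and `ψ₁ ψ̄₂ = Z₃`. A root is taken
of whichever right side is nonzero at `z`; dividing `Z₃` by it gives the other component, with the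
correct square because `Z` is null. -/
theorem exists_generatingSpinor (hs : IsSmoothParam f c) (hc : IsConformalParam f c)
    (hz : z ∈ c.target) :
    ∃ D ⊆ c.target, IsOpen D ∧ z ∈ D ∧ ∃ ψ₁ ψ₂, IsGeneratingSpinor f c D ψ₁ ψ₂ := by
  have hZ := hs.contDiffOn_Zcomp
  have hconj : ContDiff ℝ ∞ (fun w : ℂ => star w) := Complex.conjCLE.contDiff
  by_cases hA : -Complex.I * Zcomp f c 0 z - Zcomp f c 1 z ≠ 0
  · obtain ⟨D, hD, hDo, hzD, r, hr, hr2⟩ := exists_local_sqrt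
      (g := fun ζ => -Complex.I * Zcomp f c 0 ζ - Zcomp f c 1 ζ) c.open_target
      ((contDiffOn_const.mul (hZ 0)).sub (hZ 1)) hz hA
    refine ⟨D, hD, hDo, hzD, r, fun ζ => star (Zcomp f c 2 ζ / r ζ), ?_⟩
    have key : ∀ ζ ∈ D, (Zcomp f c 2 ζ / r ζ) ^ 2 =
        -Complex.I * Zcomp f c 0 ζ + Zcomp f c 1 ζ := by
      intro ζ hζ
      obtain ⟨h1, h2⟩ := hr2 ζ hζ
      rw [div_pow, div_eq_iff (pow_ne_zero 2 h2), h1]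
      linear_combination hc.sum_sq_Zcomp (hD hζ) - Zcomp f c 0 ζ ^ 2 * Complex.I_sq
    have hquot : ContDiffOn ℝ ∞ (fun ζ => Zcomp f c 2 ζ / r ζ) D := by
      simp only [div_eq_mul_inv]
      exact ((hZ 2).mono hD).mul (hr.inv fun ζ hζ => (hr2 ζ hζ).2)
    refine ⟨hr, hconj.comp_contDiffOn hquot,
      fun ζ hζ => ?_, fun ζ hζ => ?_, fun ζ hζ => ?_⟩
    · rw [star_star, key ζ hζ, (hr2 ζ hζ).1]
      linear_combination Zcomp f c 0 ζ * Complex.I_sq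
    · rw [star_star, key ζ hζ, (hr2 ζ hζ).1]
      ring
    · rw [star_star, mul_div_cancel₀ _ (hr2 ζ hζ).2]
  · by_cases hB : -Complex.I * Zcomp f c 0 z + Zcomp f c 1 z ≠ 0
    · obtain ⟨D, hD, hDo, hzD, r, hr, hr2⟩ := exists_local_sqrt
        (g := fun ζ => -Complex.I * Zcomp f c 0 ζ + Zcomp f c 1 ζ) c.open_target
        ((contDiffOn_const.mul (hZ 0)).add (hZ 1)) hz hB
      refine ⟨D, hD, hDo, hzD, fun ζ => Zcomp f c 2 ζ / r ζ, fun ζ => star (r ζ), ?_⟩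
      have key : ∀ ζ ∈ D, (Zcomp f c 2 ζ / r ζ) ^ 2 =
          -Complex.I * Zcomp f c 0 ζ - Zcomp f c 1 ζ := by
        intro ζ hζ
        obtain ⟨h1, h2⟩ := hr2 ζ hζ
        rw [div_pow, div_eq_iff (pow_ne_zero 2 h2), h1]
        linear_combination hc.sum_sq_Zcomp (hD hζ) - Zcomp f c 0 ζ ^ 2 * Complex.I_sq
      have hquot : ContDiffOn ℝ ∞ (fun ζ => Zcomp f c 2 ζ / r ζ) D := by
        simp only [div_eq_mul_inv]
        exact ((hZ 2).mono hD).mul (hr.inv fun ζ hζ => (hr2 ζ hζ).2)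
      refine ⟨hquot, hconj.comp_contDiffOn hr,
        fun ζ hζ => ?_, fun ζ hζ => ?_, fun ζ hζ => ?_⟩
      · rw [star_star, key ζ hζ, (hr2 ζ hζ).1]
        linear_combination Zcomp f c 0 ζ * Complex.I_sq
      · rw [star_star, key ζ hζ, (hr2 ζ hζ).1]
        ring
      · rw [star_star, div_mul_cancel₀ _ (hr2 ζ hζ).2]
    -- If both squares vanish then `Z₁ = Z₂ = 0`, so `Z₃ = 0` by nullity, against the immersion
    -- property.
    · exfalso
      push Not at hA hB
      have h1 : Zcomp f c 1 z = 0 := by linear_combination (hB - hA) / 2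
      have h0 : Zcomp f c 0 z = 0 := by
        linear_combination Complex.I / 2 * (hA + hB) + Zcomp f c 0 z * Complex.I_sq
      have h2 := hc.sum_sq_Zcomp hz
      rw [h0, h1] at h2
      have h2' : Zcomp f c 2 z = 0 := by simpa using h2
      obtain ⟨k, hk⟩ := hc.exists_Zcomp_ne_zero hz
      fin_cases k
      exacts [hk h0, hk h1, hk h2']

/-! ### The potentials of a generating spinor -/

/-- The potential of the Dirac operator of a generating spinor. -/
def diracPotential (f : M → Nil) (c : OpenPartialHomeomorph M ℂ) (ψ₁ ψ₂ : ℂ → ℂ) (z : ℂ) : ℂ :=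
  (meanCurvatureIn f c z : ℂ) / 2 * (ψ₁ z * star (ψ₁ z) + ψ₂ z * star (ψ₂ z)) +
    Complex.I / 4 * (ψ₂ z * star (ψ₂ z) - ψ₁ z * star (ψ₁ z))

theorem leftDeriv_one_eq_Zcomp (k : Fin 3) :
    (leftDeriv f c 1 z k : ℂ) = Zcomp f c k z + star (Zcomp f c k z) := by
  simp only [Zcomp]
  simp
  ring

theorem leftDeriv_I_eq_Zcomp (k : Fin 3) :
    (leftDeriv f c Complex.I z k : ℂ) = Complex.I * (Zcomp f c k z - star (Zcomp f c k z)) := by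
  simp only [Zcomp]
  simp
  linear_combination -(leftDeriv f c Complex.I z k : ℂ) * -Complex.I_sq

variable {D : Set ℂ} {ψ₁ ψ₂ U V : ℂ → ℂ}

theorem IsGeneratingSpinor.star_Zcomp (h : IsGeneratingSpinor f c D ψ₁ ψ₂) (hz : z ∈ D) :
    star (Zcomp f c 0 z) = -Complex.I / 2 * (ψ₂ z ^ 2 + star (ψ₁ z) ^ 2) ∧
      star (Zcomp f c 1 z) = 1 / 2 * (ψ₂ z ^ 2 - star (ψ₁ z) ^ 2) ∧
      star (Zcomp f c 2 z) = star (ψ₁ z) * ψ₂ z := by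
  rw [h.eq₁ z hz, h.eq₂ z hz, h.eq₃ z hz]
  simp

theorem IsGeneratingSpinor.firstForm_eq (h : IsGeneratingSpinor f c D ψ₁ ψ₂) (hz : z ∈ D) :
    (firstForm f c 1 1 z : ℂ) = (ψ₁ z * star (ψ₁ z) + ψ₂ z * star (ψ₂ z)) ^ 2 := by
  obtain ⟨h0, h1, h2⟩ := h.star_Zcomp hz
  rw [Nil.firstForm_eq, dotProduct, Fin.sum_univ_three]
  push_cast
  simp only [leftDeriv_one_eq_Zcomp, h0, h1, h2]
  simp only [h.eq₁ z hz, h.eq₂ z hz, h.eq₃ z hz]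
  generalize star (ψ₁ z) = P
  generalize star (ψ₂ z) = Q
  linear_combination (Q ^ 2 + ψ₁ z ^ 2 - ψ₂ z ^ 2 - P ^ 2) ^ 2 / 4 * Complex.I_sq

theorem IsGeneratingSpinor.normal_two_eq (h : IsGeneratingSpinor f c D ψ₁ ψ₂) (hz : z ∈ D) :
    (normal f c z 2 : ℂ) = (ψ₁ z * star (ψ₁ z) + ψ₂ z * star (ψ₂ z)) *
      (ψ₂ z * star (ψ₂ z) - ψ₁ z * star (ψ₁ z)) := by
  obtain ⟨h0, h1, -⟩ := h.star_Zcomp hz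
  rw [normal, crossProduct_apply_two]
  push_cast
  simp only [leftDeriv_one_eq_Zcomp, leftDeriv_I_eq_Zcomp, h0, h1]
  simp only [h.eq₁ z hz, h.eq₂ z hz]
  generalize star (ψ₁ z) = P
  generalize star (ψ₂ z) = Q
  linear_combination -(ψ₂ z ^ 2 * Q ^ 2 - ψ₁ z ^ 2 * P ^ 2) * Complex.I_sq

theorem IsGeneratingSpinor.spinor_ne_zero (h : IsGeneratingSpinor f c D ψ₁ ψ₂)
    (hc : IsConformalParam f c) (hD : D ⊆ c.target) (hz : z ∈ D) :
    ψ₁ z ≠ 0 ∨ ψ₂ z ≠ 0 := by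
  by_contra! h0
  have h1 := h.firstForm_eq hz
  rw [h0.1, h0.2] at h1
  have h2 := (hc z (hD hz)).1
  have h3 : firstForm f c 1 1 z = 0 := by simpa using h1
  exact h2.ne' h3

/-- The Wirtinger derivatives of `Z` in terms of the spinor. -/
theorem IsGeneratingSpinor.dzbar_Zcomp (h : IsGeneratingSpinor f c D ψ₁ ψ₂)
    (hs : IsSmoothParam f c) (hc : IsConformalParam f c) (hD : D ⊆ c.target) (hz : z ∈ D) :
    -Complex.I * dzbar (Zcomp f c 0) z - dzbar (Zcomp f c 1) z =
        2 * ψ₁ z * (diracPotential f c ψ₁ ψ₂ z * ψ₂ z) ∧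
      -Complex.I * dzbar (Zcomp f c 0) z + dzbar (Zcomp f c 1) z =
        2 * star (ψ₂ z) * -(star (diracPotential f c ψ₁ ψ₂ z) * star (ψ₁ z)) ∧
      dzbar (Zcomp f c 2) z = star (ψ₂ z) * (diracPotential f c ψ₁ ψ₂ z * ψ₂ z) +
        ψ₁ z * -(star (diracPotential f c ψ₁ ψ₂ z) * star (ψ₁ z)) := by
  obtain ⟨h0, h1, h2⟩ := h.star_Zcomp hz
  have hn := h.normal_two_eq hz
  have ht := hc.tension_eq hs (hD hz)
  -- This is the real part of `4 ∂̄Z_k`, and the only place where `H` enters the Dirac equation.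
  have hdiv : ∀ k, divLeftDeriv f c z k = 2 * meanCurvatureIn f c z * normal f c z k -
      nabla (leftDeriv f c 1 z) (leftDeriv f c 1 z) k -
      nabla (leftDeriv f c Complex.I z) (leftDeriv f c Complex.I z) k := by
    intro k
    have := congrFun ht k
    rw [tension_apply, Pi.smul_apply, smul_eq_mul] at this
    linear_combination this
  have e0 := hs.dzbar_Zcomp (hD hz) 0
  have e1 := hs.dzbar_Zcomp (hD hz) 1
  have e2 := hs.dzbar_Zcomp (hD hz) 2
  rw [hdiv] at e0 e1 e2
  have hst : star (diracPotential f c ψ₁ ψ₂ z) =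
      (meanCurvatureIn f c z : ℂ) / 2 * (ψ₁ z * star (ψ₁ z) + ψ₂ z * star (ψ₂ z)) -
        Complex.I / 4 * (ψ₂ z * star (ψ₂ z) - ψ₁ z * star (ψ₁ z)) := by
    simp [diracPotential]
    ring
  rw [hst, diracPotential]
  have hn0 : normal f c z 0 = leftDeriv f c 1 z 1 * leftDeriv f c Complex.I z 2 -
      leftDeriv f c 1 z 2 * leftDeriv f c Complex.I z 1 := by simp [normal, cross_apply]
  have hn1 : normal f c z 1 = leftDeriv f c 1 z 2 * leftDeriv f c Complex.I z 0 -
      leftDeriv f c 1 z 0 * leftDeriv f c Complex.I z 2 := by simp [normal, cross_apply]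
  simp only [nabla_apply, Matrix.cons_val, hn0, hn1] at e0 e1 e2
  push_cast at e0 e1 e2
  rw [hn] at e2
  simp only [leftDeriv_one_eq_Zcomp, leftDeriv_I_eq_Zcomp, h0, h1, h2] at e0 e1 e2
  simp only [h.eq₁ z hz, h.eq₂ z hz, h.eq₃ z hz] at e0 e1 e2
  -- With the conjugates treated as independent variables, the three claims are polynomial
  -- identities modulo `I² = -1`.
  generalize star (ψ₁ z) = P at *
  generalize star (ψ₂ z) = Q at *
  generalize dzbar (Zcomp f c 0) z = z0 at *
  generalize dzbar (Zcomp f c 1) z = z1 at *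
  generalize dzbar (Zcomp f c 2) z = z2 at *
  generalize (meanCurvatureIn f c z : ℂ) = H at *
  generalize ψ₁ z = p at *
  generalize ψ₂ z = q at *
  clear h h0 h1 h2 hn ht hdiv hst hn0 hn1
  have hI := Complex.I_sq
  generalize Complex.I = I at *
  refine ⟨?_, ?_, ?_⟩ <;> grind

end Surface

/-! ### The Dirac equation and the uniqueness of its potentials. -/

section Surface

variable {M : Type*} [TopologicalSpace M]
variable {f : M → Nil} {c : OpenPartialHomeomorph M ℂ} {z : ℂ}
variable {D : Set ℂ} {ψ₁ ψ₂ U V : ℂ → ℂ}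

theorem IsGeneratingSpinor.differentiableAt (h : IsGeneratingSpinor f c D ψ₁ ψ₂)
    (hDo : IsOpen D) (hz : z ∈ D) : DifferentiableAt ℝ ψ₁ z ∧ DifferentiableAt ℝ ψ₂ z :=
  ⟨(h.smooth₁.contDiffAt (hDo.mem_nhds hz)).differentiableAt (by simp),
    (h.smooth₂.contDiffAt (hDo.mem_nhds hz)).differentiableAt (by simp)⟩

/-- The Dirac equation `∂ψ₂ = -U ψ₁`, `∂̄ψ₁ = U ψ₂`. -/
theorem IsGeneratingSpinor.dirac (h : IsGeneratingSpinor f c D ψ₁ ψ₂)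
    (hs : IsSmoothParam f c) (hc : IsConformalParam f c) (hDo : IsOpen D) (hD : D ⊆ c.target)
    (hz : z ∈ D) :
    dzbar ψ₁ z = diracPotential f c ψ₁ ψ₂ z * ψ₂ z ∧
      dz ψ₂ z = -(diracPotential f c ψ₁ ψ₂ z * ψ₁ z) := by
  obtain ⟨d1, d2⟩ := h.differentiableAt hDo hz
  have d2' : DifferentiableAt ℝ (fun ζ => star (ψ₂ ζ)) z :=
    (Complex.conjCLE : ℂ →L[ℝ] ℂ).differentiableAt.comp z d2
  have hZ := fun k => (hs.hasFDerivAt_Zcomp (hD hz) k).differentiableAt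
  have hev : ∀ g₁ g₂ : ℂ → ℂ, (∀ ζ ∈ D, g₁ ζ = g₂ ζ) → dzbar g₁ z = dzbar g₂ z :=
    fun g₁ g₂ hg => dzbar_congr (by filter_upwards [hDo.mem_nhds hz] with ζ hζ using hg ζ hζ)
  have e1 := hev (fun ζ => -Complex.I * Zcomp f c 0 ζ + -1 * Zcomp f c 1 ζ)
    (fun ζ => ψ₁ ζ * ψ₁ ζ) fun ζ hζ => by
      simp only [h.eq₁ ζ hζ, h.eq₂ ζ hζ]
      linear_combination -(star (ψ₂ ζ) ^ 2 + ψ₁ ζ ^ 2) / 2 * Complex.I_sq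
  have e2 := hev (fun ζ => -Complex.I * Zcomp f c 0 ζ + Zcomp f c 1 ζ)
    (fun ζ => star (ψ₂ ζ) * star (ψ₂ ζ)) fun ζ hζ => by
      simp only [h.eq₁ ζ hζ, h.eq₂ ζ hζ]
      linear_combination -(star (ψ₂ ζ) ^ 2 + ψ₁ ζ ^ 2) / 2 * Complex.I_sq
  have e3 := hev (Zcomp f c 2) (fun ζ => ψ₁ ζ * star (ψ₂ ζ)) h.eq₃
  rw [dzbar_add ((hZ 0).const_mul _) ((hZ 1).const_mul _),
    dzbar_mul (differentiableAt_const _) (hZ 0), dzbar_mul (differentiableAt_const _) (hZ 1),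
    dzbar_mul d1 d1, dzbar_const, dzbar_const] at e1
  rw [dzbar_add ((hZ 0).const_mul _) (hZ 1), dzbar_mul (differentiableAt_const _) (hZ 0),
    dzbar_mul d2' d2', dzbar_const] at e2
  rw [dzbar_mul d1 d2'] at e3
  obtain ⟨z1, z2, z3⟩ := h.dzbar_Zcomp hs hc hD hz
  have key : dzbar ψ₁ z = diracPotential f c ψ₁ ψ₂ z * ψ₂ z ∧
      dzbar (fun ζ => star (ψ₂ ζ)) z = -(star (diracPotential f c ψ₁ ψ₂ z) * star (ψ₁ z)) := by
    -- Differentiating the squares determines `∂̄ψ₁` or `∂̄ψ̄₂` only where that component is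
    -- nonzero. At least one is, and the derivative of `ψ₁ ψ̄₂` then yields the other.
    by_cases hp : ψ₁ z = 0
    · have hq : ψ₂ z ≠ 0 := (h.spinor_ne_zero hc hD hz).resolve_left (not_not.2 hp)
      have hq' : star (ψ₂ z) ≠ 0 := star_ne_zero.2 hq
      have k2 : dzbar (fun ζ => star (ψ₂ ζ)) z =
          -(star (diracPotential f c ψ₁ ψ₂ z) * star (ψ₁ z)) :=
        mul_left_cancel₀ (mul_ne_zero two_ne_zero hq') (by linear_combination z2 - e2)
      refine ⟨mul_left_cancel₀ hq' ?_, k2⟩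
      linear_combination z3 - e3 - ψ₁ z * k2
    · have k1 : dzbar ψ₁ z = diracPotential f c ψ₁ ψ₂ z * ψ₂ z :=
        mul_left_cancel₀ (mul_ne_zero two_ne_zero hp) (by linear_combination z1 - e1)
      refine ⟨k1, mul_left_cancel₀ hp ?_⟩
      linear_combination z3 - e3 - star (ψ₂ z) * k1
  refine ⟨key.1, ?_⟩
  have k2 := key.2
  rw [dzbar_star d2] at k2
  have := congrArg star k2
  simpa using this

theorem IsGeneratingSpinor.continuousOn_diracPotential (h : IsGeneratingSpinor f c D ψ₁ ψ₂)
    (hs : IsSmoothParam f c) (hc : IsConformalParam f c) (hD : D ⊆ c.target) :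
    ContinuousOn (diracPotential f c ψ₁ ψ₂) D := by
  have h1 := h.smooth₁.continuousOn
  have h2 := h.smooth₂.continuousOn
  have hH := Complex.continuous_ofReal.comp_continuousOn
    ((hc.continuousOn_meanCurvatureIn hs).mono hD)
  exact ((hH.div_const 2).mul ((h1.mul h1.star).add (h2.mul h2.star))).add
    (continuousOn_const.mul ((h2.mul h2.star).sub (h1.mul h1.star)))

theorem IsGeneratingSpinor.isDiracPotential (h : IsGeneratingSpinor f c D ψ₁ ψ₂)
    (hs : IsSmoothParam f c) (hc : IsConformalParam f c) (hDo : IsOpen D) (hD : D ⊆ c.target) :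
    IsDiracPotential D ψ₁ ψ₂ (diracPotential f c ψ₁ ψ₂) (diracPotential f c ψ₁ ψ₂) where
  continuous₁ := h.continuousOn_diracPotential hs hc hD
  continuous₂ := h.continuousOn_diracPotential hs hc hD
  eq₁ z hz := by rw [(h.dirac hs hc hDo hD hz).2]; ring
  eq₂ z hz := by rw [(h.dirac hs hc hDo hD hz).1]; ring

theorem diracPotential_im :
    (diracPotential f c ψ₁ ψ₂ z).im =
      (Complex.normSq (ψ₂ z) - Complex.normSq (ψ₁ z)) / 4 := by
  have h : ∀ w : ℂ, w * star w = (Complex.normSq w : ℂ) := fun w => Complex.mul_conj w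
  have : diracPotential f c ψ₁ ψ₂ z =
      ((meanCurvatureIn f c z / 2 * (Complex.normSq (ψ₁ z) + Complex.normSq (ψ₂ z)) : ℝ) : ℂ) +
      (((Complex.normSq (ψ₂ z) - Complex.normSq (ψ₁ z)) / 4 : ℝ) : ℂ) * Complex.I := by
    rw [diracPotential, h, h]
    push_cast
    ring
  rw [this, Complex.add_im, Complex.ofReal_im, Complex.im_ofReal_mul, Complex.I_im]
  ring

/-- The components of a generating spinor vanish on no open set. -/
theorem IsGeneratingSpinor.not_eventually_eq_zero (h : IsGeneratingSpinor f c D ψ₁ ψ₂)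
    (hs : IsSmoothParam f c) (hc : IsConformalParam f c) (hDo : IsOpen D) (hD : D ⊆ c.target)
    (hz : z ∈ D) : ¬ (∀ᶠ ζ in nhds z, ψ₁ ζ = 0) ∧ ¬ (∀ᶠ ζ in nhds z, ψ₂ ζ = 0) := by
  obtain ⟨e1, e2⟩ := h.dirac hs hc hDo hD hz
  have hne := h.spinor_ne_zero hc hD hz
  have him := diracPotential_im (f := f) (c := c) (ψ₁ := ψ₁) (ψ₂ := ψ₂) (z := z)
  constructor
  · intro h0
    have hp : ψ₁ z = 0 := h0.self_of_nhds
    have hq : ψ₂ z ≠ 0 := hne.resolve_left (not_not.2 hp)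
    -- The Dirac equation forces the potential to vanish at `z`, while its imaginary part there is
    -- `|ψ₂|²/4 > 0`.
    rw [dzbar_congr (h := fun _ => 0) h0, dzbar_const] at e1
    rw [(mul_eq_zero.1 e1.symm).resolve_right hq, hp] at him
    have := Complex.normSq_pos.2 hq
    simp at him
    linarith
  · intro h0
    have hq : ψ₂ z = 0 := h0.self_of_nhds
    have hp : ψ₁ z ≠ 0 := hne.resolve_right (not_not.2 hq)
    rw [dz_congr (h := fun _ => 0) h0, dz_const] at e2
    rw [(mul_eq_zero.1 (neg_eq_zero.1 e2.symm)).resolve_right hp, hq] at him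
    have := Complex.normSq_pos.2 hp
    simp at him
    linarith

/-- The continuous potentials of a generating spinor are unique. -/
theorem IsDiracPotential.eq_diracPotential (hUV : IsDiracPotential D ψ₁ ψ₂ U V)
    (h : IsGeneratingSpinor f c D ψ₁ ψ₂)
    (hs : IsSmoothParam f c) (hc : IsConformalParam f c) (hDo : IsOpen D) (hD : D ⊆ c.target)
    (hz : z ∈ D) : U z = diracPotential f c ψ₁ ψ₂ z ∧ V z = diracPotential f c ψ₁ ψ₂ z := by
  have hcont := h.continuousOn_diracPotential hs hc hD
  obtain ⟨h1, h2⟩ := h.not_eventually_eq_zero hs hc hDo hD hz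
  have hD' := hDo.mem_nhds hz
  constructor
  · by_contra hne
    refine h1 ?_
    -- By continuity a discrepancy at `z` persists nearby. Subtracting the two Dirac equations would
    -- then make `ψ₁` vanish on a neighbourhood.
    filter_upwards [hD', ((hUV.continuous₁.continuousAt hD').sub
      (hcont.continuousAt hD')).eventually_ne (sub_ne_zero.2 hne)] with ζ hζ hζ'
    have e1 := hUV.eq₁ ζ hζ
    rw [(h.dirac hs hc hDo hD hζ).2] at e1
    exact (mul_eq_zero.1 (show (U ζ - diracPotential f c ψ₁ ψ₂ ζ) * ψ₁ ζ = 0 by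
      linear_combination e1)).resolve_left hζ'
  · by_contra hne
    refine h2 ?_
    filter_upwards [hD', ((hUV.continuous₂.continuousAt hD').sub
      (hcont.continuousAt hD')).eventually_ne (sub_ne_zero.2 hne)] with ζ hζ hζ'
    have e2 := hUV.eq₂ ζ hζ
    rw [(h.dirac hs hc hDo hD hζ).1] at e2
    exact (mul_eq_zero.1 (show (V ζ - diracPotential f c ψ₁ ψ₂ ζ) * ψ₂ ζ = 0 by
      linear_combination e2)).resolve_left hζ'

/-! ### The energy -/

/-- With `e = |ψ₁|² + |ψ₂|²` one has `e² = E` and `|ψ₂|² - |ψ₁|² = e N₃`, so the potential is `e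
(H/2 + i N₃/4)`. -/
theorem IsGeneratingSpinor.diracPotential_sq (h : IsGeneratingSpinor f c D ψ₁ ψ₂)
    (hc : IsConformalParam f c) (hD : D ⊆ c.target) (hz : z ∈ D) :
    diracPotential f c ψ₁ ψ₂ z * diracPotential f c ψ₁ ψ₂ z = firstForm f c 1 1 z *
      ((meanCurvatureIn f c z : ℂ) ^ 2 / 4 - (normalThird f c z : ℂ) ^ 2 / 16 +
        Complex.I / 4 * (meanCurvatureIn f c z * normalThird f c z)) := by
  have hE := h.firstForm_eq hz
  have hE0 : (firstForm f c 1 1 z : ℂ) ≠ 0 := Complex.ofReal_ne_zero.2 (hc z (hD hz)).1.ne'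
  rw [hE] at hE0
  have he := (pow_ne_zero_iff two_ne_zero).1 hE0
  rw [normalThird, diracPotential]
  push_cast
  rw [h.normal_two_eq hz, hE]
  generalize star (ψ₁ z) = P at *
  generalize star (ψ₂ z) = Q at *
  field_simp
  linear_combination 64 * (ψ₂ z * Q - ψ₁ z * P) ^ 2 * Complex.I_sq

variable [ChartedSpace ℂ M]

/-- The density of the energy with respect to the area measure. -/
def energyDensity (f : M → Nil) (p : M) : ℂ :=
  (meanCurvature f p : ℂ) ^ 2 / 4 - (normalThirdAt f p : ℂ) ^ 2 / 16 +
    Complex.I / 4 * (meanCurvature f p * normalThirdAt f p)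

variable [IsManifold 𝓘(ℂ, ℂ) ω M]

theorem IsConformalImmersion.continuous_energyDensity (hf : IsConformalImmersion f) :
    Continuous (energyDensity f) := by
  have h1 := Complex.continuous_ofReal.comp hf.continuous_meanCurvature
  have h2 := Complex.continuous_ofReal.comp hf.continuous_normalThirdAt
  exact (((h1.pow 2).div_const 4).sub ((h2.pow 2).div_const 16)).add
    (continuous_const.mul (h1.mul h2))

theorem IsConformalImmersion.mul_eq_energyDensity (hf : IsConformalImmersion f)
    (hc : c ∈ IsManifold.maximalAtlas 𝓘(ℂ, ℂ) ω M) (hDo : IsOpen D) (hD : D ⊆ c.target)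
    (h : IsGeneratingSpinor f c D ψ₁ ψ₂) (hUV : IsDiracPotential D ψ₁ ψ₂ U V) (hz : z ∈ D) :
    U z * V z = firstForm f c 1 1 z • energyDensity f (c.symm z) := by
  have hs := hf.isSmoothParam hc
  have hcc := hf.isConformalParam hc
  have hsrc := c.map_target (hD hz)
  obtain ⟨hU, hV⟩ := hUV.eq_diracPotential h hs hcc hDo hD hz
  rw [hU, hV, h.diracPotential_sq hcc hD hz, energyDensity, hf.meanCurvature_eq hc hsrc,
    hf.normalThirdAt_eq hc hsrc, c.right_inv (hD hz), Complex.real_smul]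

variable [CompactSpace M] [MeasurableSpace M] [BorelSpace M]

theorem IsConformalImmersion.nonempty_spinorRepresentation (hf : IsConformalImmersion f) :
    Nonempty (SpinorRepresentation f) := by
  have hex := fun p : M => exists_generatingSpinor
    (hf.isSmoothParam (chartAt_mem_maximalAtlas p))
    (hf.isConformalParam (chartAt_mem_maximalAtlas p)) (mem_chart_target ℂ p)
  choose D hD hDo hpD ψ₁ ψ₂ hψ using hex
  obtain ⟨n, x, P, hPm, hPd, hPu, hPs⟩ := exists_finite_borel_partition
    (fun p : M => (chartAt ℂ p).source ∩ chartAt ℂ p ⁻¹' D p)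
    (fun p => (chartAt ℂ p).isOpen_inter_preimage (hDo p))
    fun p => ⟨mem_chart_source ℂ p, hpD p⟩
  exact ⟨{
    n := n
    piece := P
    measurable_piece := hPm
    disjoint_piece := hPd
    cover := hPu
    param := fun i => chartAt ℂ (x i)
    param_mem := fun i => chartAt_mem_maximalAtlas (x i)
    piece_subset := fun i => (hPs i).trans Set.inter_subset_left
    dom := fun i => D (x i)
    isOpen_dom := fun i => hDo (x i)
    dom_subset := fun i => hD (x i)
    image_subset := fun i => Set.image_subset_iff.2 ((hPs i).trans Set.inter_subset_right)
    ψ₁ := fun i => ψ₁ (x i)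
    ψ₂ := fun i => ψ₂ (x i)
    U := fun i => diracPotential f (chartAt ℂ (x i)) (ψ₁ (x i)) (ψ₂ (x i))
    V := fun i => diracPotential f (chartAt ℂ (x i)) (ψ₁ (x i)) (ψ₂ (x i))
    spinor := fun i => hψ (x i)
    dirac := fun i => (hψ (x i)).isDiracPotential (hf.isSmoothParam (chartAt_mem_maximalAtlas _))
      (hf.isConformalParam (chartAt_mem_maximalAtlas _)) (hDo _) (hD _) }⟩

theorem SpinorRepresentation.isIntegrable (S : SpinorRepresentation f)
    (hf : IsConformalImmersion f) : S.IsIntegrable := by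
  intro i
  have hi := hf.integrableOn_areaMeasure (S.param_mem i) (S.measurable_piece i) (S.piece_subset i)
    (hf.integrable_of_continuous hf.continuous_energyDensity)
  refine (integrableOn_congr_fun (fun z hz => ?_)
    (measurableSet_image (S.measurable_piece i) (S.piece_subset i))).2 hi
  exact hf.mul_eq_energyDensity (S.param_mem i) (S.isOpen_dom i) (S.dom_subset i) (S.spinor i)
    (S.dirac i) (S.image_subset i hz)

theorem SpinorRepresentation.energy_eq (S : SpinorRepresentation f)
    (hf : IsConformalImmersion f) : S.energy = ∫ p, energyDensity f p ∂areaMeasure f := by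
  have hint := hf.integrable_of_continuous hf.continuous_energyDensity
  rw [← setIntegral_univ, ← S.cover, integral_iUnion_fintype S.measurable_piece S.disjoint_piece
    fun i => hint.integrableOn, SpinorRepresentation.energy]
  refine Finset.sum_congr rfl fun i _ => ?_
  rw [hf.setIntegral_areaMeasure (S.param_mem i) (S.measurable_piece i) (S.piece_subset i)
    hint.aestronglyMeasurable]
  exact setIntegral_congr_fun (measurableSet_image (S.measurable_piece i) (S.piece_subset i))
    fun z hz => hf.mul_eq_energyDensity (S.param_mem i) (S.isOpen_dom i) (S.dom_subset i)
      (S.spinor i) (S.dirac i) (S.image_subset i hz)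

/-! ### Comparison with the curvature integral. -/

theorem IsConformalImmersion.integrable_curvature (hf : IsConformalImmersion f) :
    Integrable (fun p => meanCurvature f p ^ 2 + tangentCurvature f p / 4 - 1 / 16)
      (areaMeasure f) := by
  refine hf.integrable_of_continuous ?_
  simp only [hf.tangentCurvature_eq]
  exact ((hf.continuous_meanCurvature.pow 2).add ((continuous_const.sub
    (hf.continuous_normalThirdAt.pow 2)).div_const 4)).sub continuous_const

theorem IsConformalImmersion.integral_energyDensity [T2Space M] (hf : IsConformalImmersion f) :
    ∫ p, energyDensity f p ∂areaMeasure f = (((1 / 4 : ℝ) *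
      ∫ p, (meanCurvature f p ^ 2 + tangentCurvature f p / 4 - 1 / 16)
        ∂areaMeasure f : ℝ) : ℂ) := by
  -- The constant `1/16` cancels the term `1/4` of the curvature divided by `4`, which leaves `H² -
  -- N₃²/4` in the real part.
  have heq : ∀ p, energyDensity f p =
      1 / 4 * ((meanCurvature f p ^ 2 + tangentCurvature f p / 4 - 1 / 16 : ℝ) : ℂ) +
        Complex.I / 4 * ((meanCurvature f p * normalThirdAt f p : ℝ) : ℂ) := by
    intro p
    rw [energyDensity, hf.tangentCurvature_eq]
    push_cast
    ring
  have h2 : Integrable (fun p => meanCurvature f p * normalThirdAt f p) (areaMeasure f) :=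
    hf.integrable_of_continuous (hf.continuous_meanCurvature.mul hf.continuous_normalThirdAt)
  simp only [heq]
  rw [integral_add (hf.integrable_curvature.ofReal.const_mul _) (h2.ofReal.const_mul _),
    integral_const_mul, integral_const_mul, integral_complex_ofReal,
    integral_complex_ofReal,
    hf.integral_meanCurvature_mul_normalThirdAt]
  push_cast
  ring

end Surface

end Nil

end

theorem mainTheorem9 {M : Type*} [TopologicalSpace M] [T2Space M] [CompactSpace M]
    [ChartedSpace ℂ M] [IsManifold 𝓘(ℂ, ℂ) ω M] [MeasurableSpace M] [BorelSpace M]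
    (f : M → Nil) (hf : Nil.IsConformalImmersion f) :
    Nonempty (Nil.SpinorRepresentation f) ∧
    Integrable (fun p => Nil.meanCurvature f p ^ 2 + Nil.tangentCurvature f p / 4 - 1 / 16)
      (Nil.areaMeasure f) ∧
    ∀ S : Nil.SpinorRepresentation f, S.IsIntegrable ∧
      S.energy = (((1 / 4 : ℝ) *
        ∫ p, (Nil.meanCurvature f p ^ 2 + Nil.tangentCurvature f p / 4 - 1 / 16)
          ∂(Nil.areaMeasure f) : ℝ) : ℂ) :=
  ⟨hf.nonempty_spinorRepresentation, hf.integrable_curvature, fun S =>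
    ⟨S.isIntegrable hf, (S.energy_eq hf).trans hf.integral_energyDensity⟩⟩
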